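/- Conventions. A Riemann surface is a connected Hausdorff second countable complex manifold of dimension $1$. Let $M$ be a Riemann surface. (a) A \emph{singular complex analytic vector field} $X$ on $M$ is a nowhere vanishing holomorphic vector field on $M\setminus \mathrm{Sing}(X)$, where the singular set $\mathrm{Sing}(X)$ is the closure in $M$ of the set of zeros (of finite order), poles and isolated essential singularities of $X$. (b) A (possibly multivalued) \emph{singular complex analytic map} $\Psi$ from $M$ to $\mathbb C_t$ is a complete analytic function on $M\setminus A$ for some closed countable set $A\subset M$: it has at least one branch at every point of $M\setminus A$, every branch can be continued analytically along every path in $M\setminus A$, any two branches are analytic continuations of each other, and all continuations are branches of $\Psi$. It is \emph{additively automorphic} if any two branches $\Psi_\alpha,\Psi_\beta$ at a point differ by a constant, $\Psi_\alpha=\Psi_\beta+a_{\alpha\beta}$ with $a_{\alpha\beta}\in\mathbb C$. Its graph consists of all $(z,\Psi_\alpha(z))$ with $z\in M\setminus A$ and $\Psi_\alpha$ a branch at $z$, and is locally the graph of a branch. (c) Let $\mathcal R\subset M\times\mathbb C_t$ be a Riemann surface, that is, a connected, injectively immersed complex curve, with projections $\pi_1:\mathcal R\to M$ and $\pi_2:\mathcal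 R\to\mathbb C_t$. We say that $\mathcal R$ and $X$ \emph{follow the diagram} $$(M,X)\xleftarrow{\ \pi_1\ }\Big(\mathcal R,\pi_2^*\tfrac{\partial}{\partial t}\Big)\xrightarrow{\ \pi_2\ }\Big(\mathbb C_t,\tfrac{\partial}{\partial t}\Big),\qquad \Psi:(M,X)\to\Big(\mathbb C_t,\tfrac{\partial}{\partial t}\Big)$$ with a singular complex analytic map $\Psi$ as in (b) if $\mathcal R$ is the graph of $\Psi$, $d\pi_1$ maps $\pi_2^*\frac{\partial}{\partial t}$ to $X$ (that is, $d\pi_1(v)=d\pi_2(v)\,X$ for all tangent vectors $v$ of $\mathcal R$ over $M\setminus\mathrm{Sing}(X)$), and every branch of $\Psi$ satisfies $d\Psi(X)=1$ on $M\setminus \mathrm{Sing}(X)$ (so $\Psi=\mathrm{const}+\int\omega_X$ with $\omega_X(X)\equiv1$). \textbf{Corollary (From Riemann surfaces to vector fields).} For a Riemann surface $\mathcal R\subset M\times\mathbb C_t$ the following are equivalent. 1) $\mathcal R$ determines a singular complex analytic vector field on $M$: there is exactly one singular complex analytic vector field $X$ on $M$ such that $\mathcal R$ and $X$ follow the diagram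 with some $\Psi$. 2) $\mathcal R$ is the graph of a nonconstant additively automorphic singular complex analytic map $\Psi$. 3) The union $\Omega=\bigcup_{c\in\mathbb C}\big(\mathcal R+(0,c)\big)$ of the $t$-translates of $\mathcal R$ is open in $M\times\mathbb C_t$ and lies over the complement of a countable subset of $M$ (the projection of $\Omega$ to $M$ omits only countably many points); the decomposition of $\Omega$ into $t$-translates of $\mathcal R$ is a holomorphic foliation of $\Omega$ whose leaves are these translates (any two translates are equal or disjoint, and $\Omega$ is covered by holomorphic foliated charts onto bidiscs); and no leaf contains a plaque $D\times\{t_0\}$ with $D\subset M$ a nonempty open set (for instance a disc $D(z_0,r)$). -/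

import Mathlib

open scoped Manifold ContDiff Topology
open Set Filter

/-! ### Singular complex analytic vector fields -/

section VectorFields

variable {M : Type*} [TopologicalSpace M] [ChartedSpace ℂ M]

/-- The coefficient `f` of a (set-theoretic) vector field `X = f ∂/∂w` in the coordinate chart
of `M` at `p`, as a function of the coordinate `w`. It is only meaningful for `w` in the image
of the chart, in particular near the coordinate of `p`. -/
noncomputable def coeffAt (X : ∀ z : M, TangentSpace 𝓘(ℂ) z) (p : M) : ℂ → ℂ := fun w =>
  mfderiv 𝓘(ℂ) 𝓘(ℂ) (chartAt ℂ p) ((chartAt ℂ p).symm w) (X ((chartAt ℂ p).symm w))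

/-- `p` is a zero (of finite order) of `X`. -/
def IsZeroAt (X : ∀ z : M, TangentSpace 𝓘(ℂ) z) (p : M) : Prop :=
  AnalyticAt ℂ (coeffAt X p) (chartAt ℂ p p) ∧ coeffAt X p (chartAt ℂ p p) = 0 ∧
    ¬ ∀ᶠ w in 𝓝 (chartAt ℂ p p), coeffAt X p w = 0

/-- `p` is a pole of `X`. -/
def IsPoleAt (X : ∀ z : M, TangentSpace 𝓘(ℂ) z) (p : M) : Prop :=
  MeromorphicAt (coeffAt X p) (chartAt ℂ p p) ∧
    meromorphicOrderAt (coeffAt X p) (chartAt ℂ p p) < 0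

/-- `p` is an isolated essential singularity of `X`: the coefficient is holomorphic (possibly with
zeros) on a punctured neighbourhood of `p`, and is not meromorphic at `p`. -/
def IsEssentialAt (X : ∀ z : M, TangentSpace 𝓘(ℂ) z) (p : M) : Prop :=
  (∀ᶠ w in 𝓝[≠] (chartAt ℂ p p), AnalyticAt ℂ (coeffAt X p) w) ∧
    ¬ MeromorphicAt (coeffAt X p) (chartAt ℂ p p)

variable (M) in
/-- A singular complex analytic vector field on `M`: a nowhere zero holomorphic vector field on
the complement of a singular set, the singular set being the closure of the set of zeros, poles and
isolated essential singularities. By convention the underlying function takes the value `0` at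
every point of the singular set (also at poles and essential singularities), so that the singular
set is `{z | X z = 0}` and the field is determined by the underlying function. -/
structure SingularVectorField where
  toFun : ∀ z : M, TangentSpace 𝓘(ℂ) z
  holomorphic : ∀ z : M, toFun z ≠ 0 → AnalyticAt ℂ (coeffAt toFun z) (chartAt ℂ z z)
  singular : ∀ z : M, toFun z = 0 →
    z ∈ closure {p : M | IsZeroAt toFun p ∨ IsPoleAt toFun p ∨ IsEssentialAt toFun p}

/-- The singular set of a singular complex analytic vector field. -/
def SingularVectorField.Sing (X : SingularVectorField M) : Set M := {z | X.toFun z = 0}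

end VectorFields

/-! ### Multivalued functions -/

section Multivalued

variable {M : Type*} [TopologicalSpace M] [ChartedSpace ℂ M]

/-- Given, at every point, a set `B z` of germs, the function `g` is a *branch* on the connected
open set `V`: it is holomorphic on `V` and all its germs at points of `V` belong to `B`. -/
def IsBranchOn (B : ∀ z : M, Set (Germ (𝓝 z) ℂ)) (V : Set M) (g : M → ℂ) : Prop :=
  IsOpen V ∧ IsConnected V ∧ ContMDiffOn 𝓘(ℂ) 𝓘(ℂ) ω g V ∧
    ∀ w ∈ V, (g : Germ (𝓝 w) ℂ) ∈ B w

/-- Two germs are direct analytic continuations of each other: they are germs of one branch. -/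
def DirectContinuation (B : ∀ z : M, Set (Germ (𝓝 z) ℂ))
    (a b : Σ z : M, Germ (𝓝 z) ℂ) : Prop :=
  ∃ (V : Set M) (g : M → ℂ), IsBranchOn B V g ∧ a.1 ∈ V ∧ b.1 ∈ V ∧
    (g : Germ (𝓝 a.1) ℂ) = a.2 ∧ (g : Germ (𝓝 b.1) ℂ) = b.2

variable (M) in
/-- A singular complex analytic, possibly multivalued function on `M`, with values in `ℂ`:
a complete analytic function on the complement of a closed countable set `sing`. It is given by the
set of its germs (branches) at every point. Each point outside `sing` has a connected open
neighbourhood on the whole of which every germ of the function at one of its points continues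
analytically (so that every germ continues along every path that avoids `sing`), and any two germs
of the function are joined by a chain of direct analytic continuations. -/
structure MultivaluedFunction where
  sing : Set M
  isClosed_sing : IsClosed sing
  countable_sing : sing.Countable
  germs : ∀ z : M, Set (Germ (𝓝 z) ℂ)
  germs_nonempty_iff : ∀ z : M, (germs z).Nonempty ↔ z ∉ sing
  continuation : ∀ z ∉ sing, ∃ V : Set M, IsOpen V ∧ IsConnected V ∧ z ∈ V ∧ V ⊆ singᶜ ∧
    ∀ w ∈ V, ∀ γ ∈ germs w, ∃ g : M → ℂ, IsBranchOn germs V g ∧ (g : Germ (𝓝 w) ℂ) = γ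
  connected : ∀ (z w : M), ∀ γ ∈ germs z, ∀ δ ∈ germs w,
    Relation.ReflTransGen (DirectContinuation germs) ⟨z, γ⟩ ⟨w, δ⟩

/-- `Ψ` is additively automorphic: any two of its branches differ by an additive constant. -/
def MultivaluedFunction.AdditivelyAutomorphic (Ψ : MultivaluedFunction M) : Prop :=
  ∀ z : M, ∀ γ ∈ Ψ.germs z, ∀ δ ∈ Ψ.germs z,
    ∃ a : ℂ, γ = δ + ((fun _ => a : M → ℂ) : Germ (𝓝 z) ℂ)

/-- `Ψ` is not constant: some branch of it is not locally constant. -/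
def MultivaluedFunction.Nonconstant (Ψ : MultivaluedFunction M) : Prop :=
  ∃ z : M, ∃ γ ∈ Ψ.germs z, ∀ a : ℂ, γ ≠ ((fun _ => a : M → ℂ) : Germ (𝓝 z) ℂ)

end Multivalued

/-! ### Riemann surfaces in `M × ℂ` -/

section Surfaces

variable {M : Type*} [TopologicalSpace M] [ChartedSpace ℂ M]
variable {R : Type*} [TopologicalSpace R] [ChartedSpace ℂ R]

/-- `ι` realizes `R` as an (injectively immersed) complex submanifold of `M × ℂ`. The two
projections of `R` are `fun p => (ι p).1` and `fun p => (ι p).2`. -/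
structure IsInjectiveImmersion (ι : R → M × ℂ) : Prop where
  holomorphic : ContMDiff 𝓘(ℂ) (𝓘(ℂ).prod 𝓘(ℂ)) ω ι
  injective : Function.Injective ι
  immersion : ∀ p : R, Function.Injective (mfderiv 𝓘(ℂ) (𝓘(ℂ).prod 𝓘(ℂ)) ι p)

/-- `R` is the graph of `Ψ`: near each of its points, `R` is the graph of a branch of `Ψ`, and it
contains the graphs of all branches of `Ψ`. -/
def IsGraphOf (ι : R → M × ℂ) (Ψ : MultivaluedFunction M) : Prop :=
  (∀ p : R, ∃ g : M → ℂ, (g : Germ (𝓝 (ι p).1) ℂ) ∈ Ψ.germs (ι p).1 ∧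
      ∀ᶠ q in 𝓝 p, (ι q).2 = g (ι q).1) ∧
    ∀ z : M, ∀ γ ∈ Ψ.germs z, (z, γ.value) ∈ range ι

/-- The commutative diagram of Riemann surfaces with vector fields formed by
`π₁ : (R, π₂^* ∂/∂t) → (M, X)`, `π₂ : (R, π₂^* ∂/∂t) → (ℂ, ∂/∂t)` and the multivalued map
`Ψ : (M, X) → (ℂ, ∂/∂t)`, where `R` is the graph of `Ψ`. -/
structure FollowsDiagram (ι : R → M × ℂ) (X : SingularVectorField M)
    (Ψ : MultivaluedFunction M) : Prop where
  graph : IsGraphOf ι Ψ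
  /-- `π₁` maps `π₂^* ∂/∂t` to `X`, that is, `dπ₁ = dπ₂ ⊗ X`. -/
  pushforward : ∀ p : R, (ι p).1 ∉ X.Sing → ∀ v : TangentSpace 𝓘(ℂ) p,
    mfderiv 𝓘(ℂ) 𝓘(ℂ) (fun q => (ι q).1) p v =
      (show ℂ from mfderiv 𝓘(ℂ) 𝓘(ℂ) (fun q => (ι q).2) p v) • X.toFun (ι p).1
  /-- `Ψ` maps `X` to `∂/∂t`: every branch is a primitive of the 1-form dual to `X`. -/
  primitive : ∀ z : M, z ∉ X.Sing → ∀ g : M → ℂ, (g : Germ (𝓝 z) ℂ) ∈ Ψ.germs z →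
    (show ℂ from mfderiv 𝓘(ℂ) 𝓘(ℂ) g z (X.toFun z)) = 1

/-- The translate `R + (0, c)` of `R` in the direction of the `t`-axis. -/
def tTranslate (ι : R → M × ℂ) (c : ℂ) : R → M × ℂ := fun p => ((ι p).1, (ι p).2 + c)

/-- The union of all `t`-translates of `R`. -/
def translatesUnion (ι : R → M × ℂ) : Set (M × ℂ) := ⋃ c : ℂ, range (tTranslate ι c)

/-- `e` is a foliated chart for the family of immersed curves `leaf j : R → M × ℂ`: a
biholomorphism of an open set onto a bidisc such that each curve, as long as it stays in this
open set, runs locally in a plaque `{second coordinate = y}`, and each plaque lies in one of the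
curves. -/
structure IsFoliatedChart {J : Type*} (leaf : J → R → M × ℂ)
    (e : OpenPartialHomeomorph (M × ℂ) (ℂ × ℂ)) : Prop where
  holomorphic : ContMDiffOn (𝓘(ℂ).prod 𝓘(ℂ)) 𝓘(ℂ, ℂ × ℂ) ω e e.source
  holomorphic_symm : ContMDiffOn 𝓘(ℂ, ℂ × ℂ) (𝓘(ℂ).prod 𝓘(ℂ)) ω e.symm e.target
  target : ∃ (a b : ℂ) (r s : ℝ), 0 < r ∧ 0 < s ∧
    e.target = Metric.ball a r ×ˢ Metric.ball b s
  locally_const : ∀ (j : J) (p : R), leaf j p ∈ e.source →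
    ∀ᶠ q in 𝓝 p, (e (leaf j q)).2 = (e (leaf j p)).2
  plaque_subset : ∀ y : ℂ, ∃ j : J, {q | q ∈ e.source ∧ (e q).2 = y} ⊆ range (leaf j)

/-- The decomposition of `Ω` into the immersed curves `leaf j : R → M × ℂ` is a holomorphic
foliation of the open set `Ω` whose leaves are these curves. -/
structure IsHolomorphicFoliation {J : Type*} (Ω : Set (M × ℂ)) (leaf : J → R → M × ℂ) :
    Prop where
  isOpen : IsOpen Ω
  iUnion_eq : ⋃ j, range (leaf j) = Ω
  eq_of_meet : ∀ i j, (range (leaf i) ∩ range (leaf j)).Nonempty →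
    range (leaf i) = range (leaf j)
  exists_chart : ∀ q ∈ Ω, ∃ e : OpenPartialHomeomorph (M × ℂ) (ℂ × ℂ),
    q ∈ e.source ∧ e.source ⊆ Ω ∧ IsFoliatedChart leaf e

/-- The immersed curve `l` contains a horizontal plaque `V × {t}`, with `V` a nonempty open
subset of `M`, as an open piece. -/
def ContainsHorizontalPlaque (l : R → M × ℂ) : Prop :=
  ∃ (W : Set R) (V : Set M) (t : ℂ), IsOpen W ∧ IsOpen V ∧ V.Nonempty ∧ l '' W = V ×ˢ {t}

/-- `R` determines, through the diagram, a singular complex analytic vector field on `M`. -/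
def DeterminesVectorField (ι : R → M × ℂ) : Prop :=
  ∃! X : SingularVectorField M, ∃ Ψ : MultivaluedFunction M, FollowsDiagram ι X Ψ

/-- `R` is the graph of a nonconstant additively automorphic map. -/
def IsAdditivelyAutomorphicGraph (ι : R → M × ℂ) : Prop :=
  ∃ Ψ : MultivaluedFunction M, Ψ.AdditivelyAutomorphic ∧ Ψ.Nonconstant ∧ IsGraphOf ι Ψ

/-- The `t`-translates of `R` are the leaves of a holomorphic foliation of their union, this union
lies over the complement of a countable subset of `M`, and no leaf contains a horizontal plaque. -/
def TranslatesFoliate (ι : R → M × ℂ) : Prop :=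
  IsHolomorphicFoliation (translatesUnion ι) (tTranslate ι) ∧
    (Prod.fst '' translatesUnion ι)ᶜ.Countable ∧
    ∀ c : ℂ, ¬ ContainsHorizontalPlaque (tTranslate ι c)

end Surfaces

/-!
The middle condition, that `R` is the graph of a nonconstant additively automorphic function `Ψ`,
is compared with the two others.

*Foliations.* Translates of branches of an additively automorphic `Ψ` form the foliation given
locally by the submersions `(z, t) ↦ t - g z`, with `g` a branch, so the translates of the graph
are its leaves (`IsAdditivelyAutomorphicGraph.translatesFoliate`). Two translates are equal as soon
as they meet, because the set of points of `R` whose translate lies in another leaf is open and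
closed. Conversely, let the translates of `R` be the leaves of a foliation. If `R` were vertical at
a point, then, by invariance under translations, the foliation would be vertical along a segment of
the `t`-axis through it; the plaque of this point would be vertical, so `R` would be contained in a
vertical line, and the union of its translates would not be open
(`TranslatesFoliate.dAt_fst_ne_zero`). So `R` is locally a graph over `M`. The local graphs are the
branches of `Ψ`: over a small `V ⊆ M` carrying one branch `g`, every other branch belongs to a leaf
which is a translate of `R` meeting the graph of `g`, so it is `g + d` for a constant `d`; this
yields both continuation over all of `V` and additive automorphy.

*Vector fields.* If `X` and `Ψ` follow the diagram, all branches have the same differential, the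
dual of `X`, near a regular point of `X`; so they differ by constants there, and by analytic
continuation everywhere (`FollowsDiagram.additivelyAutomorphic`). Conversely, the differential `dΨ`
of an additively automorphic `Ψ` is a single-valued holomorphic `1`-form off the closed countable
set of singularities; `X` is its dual on the set of points at which `dΨ` extends to a holomorphic
form without zero. The complement of this set is closed and countable, so by Baire's theorem its
isolated points are dense in it, and at each of these the coefficient of `X` has a zero, a pole or
an essential singularity: in the remaining case of order `0`, `dΨ` would extend without zero
(`MultivaluedFunction.singular_of_isolated`). Finally `X` is unique: `R` determines `dΨ`, hence `X`
on a dense set, and two singular vector fields that agree on a dense set are equal, since a singular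
point of only one of them would be removable (`SingularVectorField.eq_of_dense`).
-/

/-! ### Holomorphic functions on complex curves -/

section OneDim

variable {M : Type*} [TopologicalSpace M] [ChartedSpace ℂ M]
variable {N : Type*} [TopologicalSpace N] [ChartedSpace ℂ N]

theorem analyticAt_comp_chart_symm [IsManifold 𝓘(ℂ) ω M] {g : M → ℂ} {p z : M}
    (hz : z ∈ (chartAt ℂ p).source) (hg : ContMDiffAt 𝓘(ℂ) 𝓘(ℂ) ω g z) :
    AnalyticAt ℂ (g ∘ (chartAt ℂ p).symm) (chartAt ℂ p z) := by
  have := (contMDiffAt_iff_source_of_mem_source (I := 𝓘(ℂ)) (I' := 𝓘(ℂ)) (n := ω) hz).1 hg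
  have h2 := contMDiffWithinAt_iff_contDiffWithinAt.1 this
  rw [modelWithCornersSelf_coe, range_id, contDiffWithinAt_univ] at h2
  simpa using h2.analyticAt

theorem contMDiffAt_chartAt_of_mem [IsManifold 𝓘(ℂ) ω M] {p z : M}
    (hz : z ∈ (chartAt ℂ p).source) : ContMDiffAt 𝓘(ℂ) 𝓘(ℂ) ω (chartAt ℂ p) z :=
  contMDiffOn_chart.contMDiffAt ((chartAt ℂ p).open_source.mem_nhds hz)

theorem AnalyticAt.contMDiffAt_comp_chart [IsManifold 𝓘(ℂ) ω M] {G : ℂ → ℂ} {p z : M}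
    (hz : z ∈ (chartAt ℂ p).source) (hG : AnalyticAt ℂ G (chartAt ℂ p z)) :
    ContMDiffAt 𝓘(ℂ) 𝓘(ℂ) ω (G ∘ chartAt ℂ p) z :=
  (contMDiffAt_iff_contDiffAt.2 hG.contDiffAt).comp z (contMDiffAt_chartAt_of_mem hz)

theorem map_chart_symm_nhdsNE {p z : M} (hz : z ∈ (chartAt ℂ p).source) :
    map (chartAt ℂ p).symm (𝓝[≠] (chartAt ℂ p z)) = 𝓝[≠] z := by
  set e := (chartAt ℂ p).symm
  have h := e.map_nhdsWithin_eq (s := {chartAt ℂ p z}ᶜ) ((chartAt ℂ p).map_source hz)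
  have hz' : e (chartAt ℂ p z) = z := (chartAt ℂ p).left_inv hz
  rw [h, hz']
  apply nhdsWithin_eq_nhdsWithin hz (chartAt ℂ p).open_source
  ext w
  constructor
  · rintro ⟨⟨x, ⟨hx, hxn⟩, rfl⟩, hw⟩
    refine ⟨fun h' => hxn ?_, hw⟩
    rw [mem_singleton_iff] at h' ⊢
    rw [← h']
    exact ((chartAt ℂ p).right_inv hx).symm
  · rintro ⟨hwz, hw⟩
    refine ⟨⟨chartAt ℂ p w, ⟨(chartAt ℂ p).map_source hw, fun h' => hwz ?_⟩,
      (chartAt ℂ p).left_inv hw⟩, hw⟩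
    exact (chartAt ℂ p).injOn hw hz h'

theorem map_chart_symm_nhds {p z : M} (hz : z ∈ (chartAt ℂ p).source) :
    map (chartAt ℂ p).symm (𝓝 (chartAt ℂ p z)) = 𝓝 z :=
  (chartAt ℂ p).symm_map_nhds_eq hz

theorem nhdsNE_neBot_of_chartedSpace (z : M) : (𝓝[≠] z).NeBot := by
  rw [← map_chart_symm_nhdsNE (mem_chart_source ℂ z)]
  infer_instance

theorem not_countable_of_isOpen {O : Set M} (hO : IsOpen O) (hne : O.Nonempty) :
    ¬ O.Countable := by
  intro hc
  obtain ⟨z, hz⟩ := hne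
  have h1 : O ∩ (chartAt ℂ z).source ∈ 𝓝 z :=
    inter_mem (hO.mem_nhds hz) (chart_source_mem_nhds ℂ z)
  have h2 := (chartAt ℂ z).image_mem_nhds (mem_chart_source ℂ z) h1
  have h3 : ((chartAt ℂ z) '' (O ∩ (chartAt ℂ z).source)).Countable :=
    (hc.mono inter_subset_left).image _
  have h4 := h3.dense_compl ℂ
  obtain ⟨x, hx1, hx2⟩ := h4.inter_nhds_nonempty h2
  exact hx1 hx2

/-- A countable subset of a complex curve has dense complement. -/
theorem Set.Countable.dense_compl_of_chartedSpace {A : Set M} (hA : A.Countable) :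
    Dense Aᶜ := by
  rw [dense_iff_inter_open]
  intro U hU hne
  by_contra h
  refine not_countable_of_isOpen hU hne (hA.mono fun x hx => ?_)
  by_contra hxA
  exact h ⟨x, hx, hxA⟩

theorem eventually_eq_or_eventually_ne_complex [IsManifold 𝓘(ℂ) ω M] {g : M → ℂ} {p : M}
    (hg : ContMDiffAt 𝓘(ℂ) 𝓘(ℂ) ω g p) (c : ℂ) :
    (∀ᶠ q in 𝓝 p, g q = c) ∨ ∀ᶠ q in 𝓝[≠] p, g q ≠ c := by
  have h := analyticAt_comp_chart_symm (mem_chart_source ℂ p) hg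
  rw [← map_chart_symm_nhdsNE (mem_chart_source ℂ p), ← map_chart_symm_nhds (mem_chart_source ℂ p)]
  simp only [eventually_map]
  exact h.eventually_eq_or_eventually_ne analyticAt_const

/-- Isolated values: a holomorphic map between complex curves either equals `c` near `p`, or omits
`c` on a punctured neighbourhood of `p`. -/
theorem eventually_eq_or_eventually_ne [IsManifold 𝓘(ℂ) ω M] [IsManifold 𝓘(ℂ) ω N] [T1Space N]
    {f : M → N} {p : M} (hf : ContMDiffAt 𝓘(ℂ) 𝓘(ℂ) ω f p) (c : N) :
    (∀ᶠ q in 𝓝 p, f q = c) ∨ ∀ᶠ q in 𝓝[≠] p, f q ≠ c := by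
  by_cases hc : f p = c
  · subst hc
    have h1 := (contMDiffAt_chartAt_of_mem (mem_chart_source ℂ (f p))).comp p hf
    have h2 : ∀ᶠ q in 𝓝 p, f q ∈ (chartAt ℂ (f p)).source :=
      hf.continuousAt (chart_source_mem_nhds ℂ (f p))
    refine (eventually_eq_or_eventually_ne_complex h1 (chartAt ℂ (f p) (f p))).imp ?_ ?_
    · intro h
      filter_upwards [h, h2] with q hq hq2
      exact (chartAt ℂ (f p)).injOn hq2 (mem_chart_source ℂ _) hq
    · intro h
      filter_upwards [h] with q hq hq2
      exact hq (by simp [hq2])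
  · right
    exact (hf.continuousAt.eventually_ne hc).filter_mono nhdsWithin_le_nhds

/-- The open mapping theorem for holomorphic maps between complex curves. -/
theorem eventually_const_or_nhds_le_map [IsManifold 𝓘(ℂ) ω M] [IsManifold 𝓘(ℂ) ω N]
    {f : M → N} {p : M} (hf : ContMDiffAt 𝓘(ℂ) 𝓘(ℂ) ω f p) :
    (∀ᶠ q in 𝓝 p, f q = f p) ∨ 𝓝 (f p) ≤ map f (𝓝 p) := by
  have h1 := (contMDiffAt_chartAt_of_mem (mem_chart_source ℂ (f p))).comp p hf
  have h2 : ∀ᶠ q in 𝓝 p, f q ∈ (chartAt ℂ (f p)).source :=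
    hf.continuousAt (chart_source_mem_nhds ℂ (f p))
  have h3 := analyticAt_comp_chart_symm (mem_chart_source ℂ p) h1
  refine h3.eventually_constant_or_nhds_le_map_nhds.imp ?_ ?_
  · intro h
    have h4 : ∀ᶠ q in 𝓝 p, chartAt ℂ (f p) (f q) = chartAt ℂ (f p) (f p) := by
      rw [← map_chart_symm_nhds (mem_chart_source ℂ p)]
      simpa using h
    filter_upwards [h4, h2] with q hq hq2
    exact (chartAt ℂ (f p)).injOn hq2 (mem_chart_source ℂ _) hq
  · intro h
    rw [← map_map, map_chart_symm_nhds (mem_chart_source ℂ p)] at h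
    simp only [Function.comp_apply, (chartAt ℂ p).left_inv (mem_chart_source ℂ p)] at h
    intro s hs
    have h5 : {q | f q ∈ s ∧ f q ∈ (chartAt ℂ (f p)).source} ∈ 𝓝 p :=
      (Filter.Eventually.and hs h2)
    have h6 : (chartAt ℂ (f p) ∘ f) '' {q | f q ∈ s ∧ f q ∈ (chartAt ℂ (f p)).source} ∈
        𝓝 (chartAt ℂ (f p) (f p)) := h (image_mem_map h5)
    have h7 := (chartAt ℂ (f p)).continuousAt (mem_chart_source ℂ (f p)) h6
    filter_upwards [h7, chart_source_mem_nhds ℂ (f p)] with y hy hy2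
    obtain ⟨q, ⟨hq1, hq2⟩, hq3⟩ := hy
    rwa [← (chartAt ℂ (f p)).injOn hq2 hy2 hq3]

/-- The identity theorem: a holomorphic map on a connected set that takes the value `c` on a
neighbourhood of one of its points takes it near all of them. -/
theorem IsPreconnected.eventually_eq_const [IsManifold 𝓘(ℂ) ω M] [IsManifold 𝓘(ℂ) ω N]
    [T1Space N] {f : M → N} {V : Set M} (hV : IsPreconnected V)
    (hf : ∀ z ∈ V, ContMDiffAt 𝓘(ℂ) 𝓘(ℂ) ω f z) {c : N} {z w : M} (hz : z ∈ V) (hw : w ∈ V)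
    (h : ∀ᶠ q in 𝓝 z, f q = c) : ∀ᶠ q in 𝓝 w, f q = c := by
  refine (hV.induction₂ (fun x y => (∀ᶠ q in 𝓝 x, f q = c) ↔ ∀ᶠ q in 𝓝 y, f q = c) ?_
    (fun _ _ _ _ _ _ => Iff.trans) (fun _ _ _ _ => Iff.symm) hz hw).1 h
  intro x hx
  refine Filter.Eventually.filter_mono nhdsWithin_le_nhds ?_
  rcases eventually_eq_or_eventually_ne (hf x hx) c with h1 | h1
  · filter_upwards [h1.eventually_nhds] with y hy
    exact ⟨fun _ => hy, fun _ => h1⟩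
  · rw [eventually_nhdsWithin_iff] at h1
    filter_upwards [h1] with y hy
    by_cases hyx : y = x
    · rw [hyx]
    · refine ⟨fun h2 => ?_, fun h2 => absurd h2.self_of_nhds (hy hyx)⟩
      have := nhdsNE_neBot_of_chartedSpace x
      obtain ⟨q, hq1, hq2⟩ := ((h2.filter_mono nhdsWithin_le_nhds).and
        (eventually_nhdsWithin_iff.2 h1)).exists
      exact absurd hq1 hq2

/-- The differential of `g` at `z`, as a number: its value at `1`. Here the tangent space at `z` is
identified with `ℂ` by means of the preferred chart of `M` at `z`. -/
noncomputable def dAt (g : M → ℂ) (z : M) : ℂ :=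
  mfderiv 𝓘(ℂ) 𝓘(ℂ) g z (1 : ℂ)

theorem mfderiv_apply_eq_mul (g : M → ℂ) (z : M) (v : ℂ) :
    (mfderiv 𝓘(ℂ) 𝓘(ℂ) g z v : ℂ) = v * dAt g z := by
  have h := (mfderiv 𝓘(ℂ) 𝓘(ℂ) g z).map_smul v (1 : ℂ)
  have h' : v • (1 : ℂ) = v := mul_one v
  rw [← congrArg (fun u : ℂ => (mfderiv 𝓘(ℂ) 𝓘(ℂ) g z u : ℂ)) h']
  exact h

theorem mfderiv_eq_zero_iff_dAt {g : M → ℂ} {z : M} :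
    mfderiv 𝓘(ℂ) 𝓘(ℂ) g z = 0 ↔ dAt g z = 0 := by
  constructor
  · intro h
    simp only [dAt, h]
    rfl
  · intro h
    refine ContinuousLinearMap.ext fun v => ?_
    exact (mfderiv_apply_eq_mul g z v).trans (by rw [h]; exact mul_zero (show ℂ from v))

theorem dAt_chart_ne_zero [IsManifold 𝓘(ℂ) ω M] {p z : M} (hz : z ∈ (chartAt ℂ p).source) :
    dAt (chartAt ℂ p) z ≠ 0 := by
  intro h
  have : IsManifold 𝓘(ℂ) 1 M := .of_le (n := ω) le_top
  have h1 := (mdifferentiable_chart (I := 𝓘(ℂ)) p).mfderiv_injective hz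
  have h2 := mfderiv_eq_zero_iff_dAt.2 h
  have h3 := @h1 (1 : ℂ) (0 : ℂ)
    (by rw [h2]; rfl)
  exact one_ne_zero (α := ℂ) h3

/-- The differential of `g`, computed in a chart around `z` that need not be the preferred one. -/
theorem dAt_eq_deriv_mul [IsManifold 𝓘(ℂ) ω M] {g : M → ℂ} {p z : M}
    (hz : z ∈ (chartAt ℂ p).source) (hg : ContMDiffAt 𝓘(ℂ) 𝓘(ℂ) ω g z) :
    dAt g z = deriv (g ∘ (chartAt ℂ p).symm) (chartAt ℂ p z) * dAt (chartAt ℂ p) z := by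
  set G := g ∘ (chartAt ℂ p).symm with hG
  have hGa := analyticAt_comp_chart_symm hz hg
  have h1 : g =ᶠ[𝓝 z] G ∘ chartAt ℂ p := by
    filter_upwards [(chartAt ℂ p).open_source.mem_nhds hz] with w hw
    simp [hG, hw]
  have h2 : mfderiv 𝓘(ℂ) 𝓘(ℂ) g z = mfderiv 𝓘(ℂ) 𝓘(ℂ) (G ∘ chartAt ℂ p) z := h1.mfderiv_eq
  have h3 : mfderiv 𝓘(ℂ) 𝓘(ℂ) (G ∘ chartAt ℂ p) z =
      (mfderiv 𝓘(ℂ) 𝓘(ℂ) G (chartAt ℂ p z)).comp (mfderiv 𝓘(ℂ) 𝓘(ℂ) (chartAt ℂ p) z) :=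
    mfderiv_comp z hGa.differentiableAt.mdifferentiableAt
      ((contMDiffAt_chartAt_of_mem hz).mdifferentiableAt (by simp))
  have h4 : dAt g z = mfderiv 𝓘(ℂ) 𝓘(ℂ) G (chartAt ℂ p z)
      (mfderiv 𝓘(ℂ) 𝓘(ℂ) (chartAt ℂ p) z (1 : ℂ)) := by
    unfold dAt
    rw [h2, h3]
    rfl
  rw [h4, mfderiv_eq_fderiv]
  have h5 := (fderiv ℂ G (chartAt ℂ p z)).map_smul (dAt (chartAt ℂ p) z) 1
  rw [smul_eq_mul, mul_one, smul_eq_mul, fderiv_apply_one_eq_deriv, mul_comm] at h5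
  exact h5

theorem coeffAt_chart_eq {X : ∀ z : M, TangentSpace 𝓘(ℂ) z} {p z : M}
    (hz : z ∈ (chartAt ℂ p).source) :
    coeffAt X p (chartAt ℂ p z) = (show ℂ from X z) * dAt (chartAt ℂ p) z := by
  rw [← mfderiv_apply_eq_mul]
  unfold coeffAt
  rw [(chartAt ℂ p).left_inv hz]

end OneDim

/-! ### Differentials and multivalued functions -/

section Derivatives

variable {M : Type*} [TopologicalSpace M] [ChartedSpace ℂ M]

theorem Filter.EventuallyEq.dAt_eq {g h : M → ℂ} {z : M} (hgh : g =ᶠ[𝓝 z] h) :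
    dAt g z = dAt h z := by
  have : mfderiv 𝓘(ℂ) 𝓘(ℂ) g z = mfderiv 𝓘(ℂ) 𝓘(ℂ) h z := hgh.mfderiv_eq
  unfold dAt
  rw [this]
  rfl

variable [IsManifold 𝓘(ℂ) ω M]

theorem ContMDiffAt.eventually_contMDiffAt {N : Type*} [TopologicalSpace N] [ChartedSpace ℂ N]
    [IsManifold 𝓘(ℂ) ω N] {f : M → N} {z : M} (hf : ContMDiffAt 𝓘(ℂ) 𝓘(ℂ) ω f z) :
    ∀ᶠ w in 𝓝 z, ContMDiffAt 𝓘(ℂ) 𝓘(ℂ) ω f w :=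
  (contMDiffAt_iff_contMDiffAt_nhds (by simp)).1 hf

theorem dAt_add_const {g : M → ℂ} {z : M} (hg : ContMDiffAt 𝓘(ℂ) 𝓘(ℂ) ω g z) (a : ℂ) :
    dAt (fun w => g w + a) z = dAt g z := by
  have hz := mem_chart_source ℂ z
  have h1 : ContMDiffAt 𝓘(ℂ) 𝓘(ℂ) ω (fun w => g w + a) z := hg.add contMDiffAt_const
  rw [dAt_eq_deriv_mul hz hg, dAt_eq_deriv_mul hz h1]
  congr 1
  exact deriv_add_const a

theorem eventually_eq_add_const_of_dAt_eq {g h : M → ℂ} {z : M}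
    (hg : ContMDiffAt 𝓘(ℂ) 𝓘(ℂ) ω g z) (hh : ContMDiffAt 𝓘(ℂ) 𝓘(ℂ) ω h z)
    (hd : ∀ᶠ w in 𝓝 z, dAt g w = dAt h w) :
    ∃ a : ℂ, g =ᶠ[𝓝 z] fun w => h w + a := by
  have hz := mem_chart_source ℂ z
  set e := chartAt ℂ z with he
  have hG := analyticAt_comp_chart_symm hz hg
  have hH := analyticAt_comp_chart_symm hz hh
  have h1 : ∀ᶠ w in 𝓝 z, w ∈ e.source ∧ ContMDiffAt 𝓘(ℂ) 𝓘(ℂ) ω g w ∧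
      ContMDiffAt 𝓘(ℂ) 𝓘(ℂ) ω h w ∧ dAt g w = dAt h w := by
    filter_upwards [chart_source_mem_nhds ℂ z, hg.eventually_contMDiffAt,
      hh.eventually_contMDiffAt, hd]
      with w a b c d using ⟨a, b, c, d⟩
  have h2 : ∀ᶠ x in 𝓝 (e z), deriv (g ∘ e.symm) x = deriv (h ∘ e.symm) x := by
    have h3 : ∀ᶠ w in 𝓝 z, deriv (g ∘ e.symm) (e w) = deriv (h ∘ e.symm) (e w) := by
      filter_upwards [h1] with w ⟨a, b, c, d⟩
      rw [dAt_eq_deriv_mul a b, dAt_eq_deriv_mul a c] at d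
      exact mul_right_cancel₀ (dAt_chart_ne_zero a) d
    rw [← map_chart_symm_nhds hz, eventually_map] at h3
    filter_upwards [h3, (chart_target_mem_nhds ℂ z)] with x hx hx2
    rwa [← he, e.right_inv hx2] at hx
  obtain ⟨r, hr, hball⟩ := Metric.eventually_nhds_iff_ball.1
    (h2.and (hG.eventually_analyticAt.and hH.eventually_analyticAt))
  have h4 : ∀ x ∈ Metric.ball (e z) r, (g ∘ e.symm) x - (h ∘ e.symm) x =
      (g ∘ e.symm) (e z) - (h ∘ e.symm) (e z) := by
    intro x hx
    refine Metric.isOpen_ball.is_const_of_deriv_eq_zero (𝕜 := ℂ)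
      (f := fun x => (g ∘ e.symm) x - (h ∘ e.symm) x)
      (convex_ball _ _).isPreconnected ?_ ?_ hx (Metric.mem_ball_self hr)
    · intro y hy
      exact ((hball y hy).2.1.differentiableAt.sub
        (hball y hy).2.2.differentiableAt).differentiableWithinAt
    · intro y hy
      have := deriv_fun_sub (hball y hy).2.1.differentiableAt (hball y hy).2.2.differentiableAt
      rw [this, (hball y hy).1, sub_self]
      rfl
  refine ⟨g z - h z, ?_⟩
  have h5 : ∀ᶠ w in 𝓝 z, e w ∈ Metric.ball (e z) r :=
    (e.continuousAt hz) (Metric.ball_mem_nhds _ hr)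
  filter_upwards [h5, chart_source_mem_nhds ℂ z] with w hw hw2
  have := h4 _ hw
  simp only [Function.comp_apply, e.left_inv hw2, e.left_inv hz] at this
  rw [← this]
  ring

/-- Differentials of two holomorphic functions that agree frequently near `z` agree at `z`. -/
theorem dAt_eq_of_frequently {g h : M → ℂ} {z : M}
    (hg : ContMDiffAt 𝓘(ℂ) 𝓘(ℂ) ω g z) (hh : ContMDiffAt 𝓘(ℂ) 𝓘(ℂ) ω h z)
    (hd : ∃ᶠ w in 𝓝 z, dAt g w = dAt h w) : dAt g z = dAt h z := by
  have hz := mem_chart_source ℂ z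
  set e := chartAt ℂ z with he
  have hc : ∀ {g : M → ℂ}, ContMDiffAt 𝓘(ℂ) 𝓘(ℂ) ω g z →
      ContinuousAt (fun w => deriv (g ∘ e.symm) (e w)) z := fun hg =>
    ((analyticAt_comp_chart_symm hz hg).deriv.continuousAt).comp (f := e) (e.continuousAt hz)
  rw [dAt_eq_deriv_mul hz hg, dAt_eq_deriv_mul hz hh]
  congr 1
  by_contra hne
  have h1 : ∀ᶠ w in 𝓝 z, deriv (g ∘ e.symm) (e w) - deriv (h ∘ e.symm) (e w) ≠ 0 :=
    ((hc hg).sub (hc hh)).eventually_ne (sub_ne_zero.2 hne)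
  refine hd ?_
  filter_upwards [h1, chart_source_mem_nhds ℂ z, hg.eventually_contMDiffAt,
    hh.eventually_contMDiffAt] with w a b c d heq
  rw [dAt_eq_deriv_mul b c, dAt_eq_deriv_mul b d] at heq
  exact a (sub_eq_zero.2 (mul_right_cancel₀ (dAt_chart_ne_zero b) heq))

end Derivatives

section Multivalued

variable {M : Type*} [TopologicalSpace M] [ChartedSpace ℂ M]

theorem germ_add_const_eq_iff {M : Type*} [TopologicalSpace M] {z : M} {g h : M → ℂ} {a : ℂ} :
    (g : Germ (𝓝 z) ℂ) = (h : Germ (𝓝 z) ℂ) + ((fun _ => a : M → ℂ) : Germ (𝓝 z) ℂ) ↔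
      g =ᶠ[𝓝 z] fun w => h w + a := by
  rw [← Germ.coe_add, Germ.coe_eq]
  rfl

theorem IsBranchOn.contMDiffAt {B : ∀ z : M, Set (Germ (𝓝 z) ℂ)} {V : Set M} {g : M → ℂ}
    (h : IsBranchOn B V g) {z : M} (hz : z ∈ V) : ContMDiffAt 𝓘(ℂ) 𝓘(ℂ) ω g z :=
  h.2.2.1.contMDiffAt (h.1.mem_nhds hz)

/-- Two functions holomorphic on a connected set that agree, up to a constant, near one of its
points do so near every one. -/
theorem IsPreconnected.eventuallyEq_add_const [IsManifold 𝓘(ℂ) ω M] {V : Set M}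
    (hV : IsPreconnected V) {g h : M → ℂ} (hg : ∀ z ∈ V, ContMDiffAt 𝓘(ℂ) 𝓘(ℂ) ω g z)
    (hh : ∀ z ∈ V, ContMDiffAt 𝓘(ℂ) 𝓘(ℂ) ω h z) {z w : M} (hz : z ∈ V) (hw : w ∈ V) {a : ℂ}
    (hgh : g =ᶠ[𝓝 z] fun q => h q + a) : g =ᶠ[𝓝 w] fun q => h q + a := by
  have h1 := hV.eventually_eq_const (f := fun q => g q - h q) (c := a)
    (fun x hx => (hg x hx).sub (hh x hx)) hz hw (by
      filter_upwards [hgh] with q hq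
      rw [hq]; ring)
  filter_upwards [h1] with q hq
  rw [← hq]; ring

namespace MultivaluedFunction

variable (Ψ : MultivaluedFunction M)

theorem notMem_sing_of_mem_germs {z : M} {γ : Germ (𝓝 z) ℂ} (h : γ ∈ Ψ.germs z) : z ∉ Ψ.sing :=
  (Ψ.germs_nonempty_iff z).1 ⟨γ, h⟩

theorem exists_germ {z : M} (hz : z ∉ Ψ.sing) : ∃ g : M → ℂ, (g : Germ (𝓝 z) ℂ) ∈ Ψ.germs z := by
  obtain ⟨γ, hγ⟩ := (Ψ.germs_nonempty_iff z).2 hz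
  induction γ using Germ.inductionOn with
  | h g => exact ⟨g, hγ⟩

/-- A representative of a germ of `Ψ` is holomorphic, and its germs at the nearby points also belong
to `Ψ`. -/
theorem eventually_of_mem_germs {z : M} {g : M → ℂ} (h : (g : Germ (𝓝 z) ℂ) ∈ Ψ.germs z) :
    ContMDiffAt 𝓘(ℂ) 𝓘(ℂ) ω g z ∧ ∀ᶠ w in 𝓝 z, (g : Germ (𝓝 w) ℂ) ∈ Ψ.germs w := by
  obtain ⟨V, hVo, -, hzV, -, hV⟩ := Ψ.continuation z (Ψ.notMem_sing_of_mem_germs h)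
  obtain ⟨g', hg', he⟩ := hV z hzV _ h
  have he' : g' =ᶠ[𝓝 z] g := Germ.coe_eq.1 he
  refine ⟨(hg'.contMDiffAt hzV).congr_of_eventuallyEq he'.symm, ?_⟩
  filter_upwards [he'.eventually_nhds, hVo.mem_nhds hzV] with w hw hwV
  have h2 := hg'.2.2.2 w hwV
  rwa [Germ.coe_eq.2 hw] at h2

theorem contMDiffAt_of_mem_germs {z : M} {g : M → ℂ} (h : (g : Germ (𝓝 z) ℂ) ∈ Ψ.germs z) :
    ContMDiffAt 𝓘(ℂ) 𝓘(ℂ) ω g z := (Ψ.eventually_of_mem_germs h).1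

/-- A property of points that is locally constant off the singular set passes from one point to
every other, because all germs are continuations of each other. -/
theorem propagate {Q : M → Prop}
    (hQ : ∀ z ∉ Ψ.sing, ∀ᶠ w in 𝓝 z, (Q z ↔ Q w)) {z w : M} (hz : z ∉ Ψ.sing)
    (hw : w ∉ Ψ.sing) (h : Q z) : Q w := by
  obtain ⟨γ, hγ⟩ := (Ψ.germs_nonempty_iff z).2 hz
  obtain ⟨δ, hδ⟩ := (Ψ.germs_nonempty_iff w).2 hw
  have key : ∀ a b : (Σ z : M, Germ (𝓝 z) ℂ),
      Relation.ReflTransGen (DirectContinuation Ψ.germs) a b → Q a.1 → Q b.1 := by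
    intro a b hab ha
    induction hab with
    | refl => exact ha
    | tail _ hbc ih =>
      obtain ⟨V, g, hV, h1, h2, -⟩ := hbc
      refine (hV.2.1.isPreconnected.induction₂ (fun x y => Q x ↔ Q y) ?_
        (fun _ _ _ _ _ _ => Iff.trans) (fun _ _ _ _ => Iff.symm) h1 h2).1 ih
      intro x hx
      exact (hQ x (Ψ.notMem_sing_of_mem_germs (hV.2.2.2 x hx))).filter_mono nhdsWithin_le_nhds
  exact key _ _ (Ψ.connected z w γ hγ δ hδ) h

/-- If the branches of `Ψ` at one point differ by constants, so do those at every point. -/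
theorem additivelyAutomorphic_of_exists [IsManifold 𝓘(ℂ) ω M] {z : M} (hz : z ∉ Ψ.sing)
    (h : ∀ γ ∈ Ψ.germs z, ∀ δ ∈ Ψ.germs z,
      ∃ a : ℂ, γ = δ + ((fun _ => a : M → ℂ) : Germ (𝓝 z) ℂ)) : Ψ.AdditivelyAutomorphic := by
  intro w γ hγ
  refine Ψ.propagate (Q := fun w => ∀ γ ∈ Ψ.germs w, ∀ δ ∈ Ψ.germs w,
      ∃ a : ℂ, γ = δ + ((fun _ => a : M → ℂ) : Germ (𝓝 w) ℂ)) ?_ hz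
      (Ψ.notMem_sing_of_mem_germs hγ) h γ hγ
  intro x hx
  obtain ⟨V, hVo, hVc, hxV, -, hV⟩ := Ψ.continuation x hx
  have key : ∀ x ∈ V, ∀ y ∈ V, (∀ γ ∈ Ψ.germs x, ∀ δ ∈ Ψ.germs x,
      ∃ a : ℂ, γ = δ + ((fun _ => a : M → ℂ) : Germ (𝓝 x) ℂ)) → (∀ γ ∈ Ψ.germs y,
      ∀ δ ∈ Ψ.germs y, ∃ a : ℂ, γ = δ + ((fun _ => a : M → ℂ) : Germ (𝓝 y) ℂ)) := by
    intro x hx y hy h γ hγ δ hδ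
    obtain ⟨g, hg, rfl⟩ := hV y hy γ hγ
    obtain ⟨k, hk, rfl⟩ := hV y hy δ hδ
    obtain ⟨a, ha⟩ := h _ (hg.2.2.2 x hx) _ (hk.2.2.2 x hx)
    refine ⟨a, germ_add_const_eq_iff.2 ?_⟩
    exact hVc.isPreconnected.eventuallyEq_add_const (fun _ h => hg.contMDiffAt h)
      (fun _ h => hk.contMDiffAt h) hx hy (germ_add_const_eq_iff.1 ha)
  filter_upwards [hVo.mem_nhds hxV] with y hy
  exact ⟨key x hxV y hy, key y hy x hxV⟩

/-- No branch of a nonconstant additively automorphic function is constant. -/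
theorem not_eventually_const [IsManifold 𝓘(ℂ) ω M] (hA : Ψ.AdditivelyAutomorphic)
    (hn : Ψ.Nonconstant) {z : M} {g : M → ℂ} (hg : (g : Germ (𝓝 z) ℂ) ∈ Ψ.germs z) (c : ℂ) :
    ¬ ∀ᶠ w in 𝓝 z, g w = c := by
  intro hc
  obtain ⟨w, γ, hγ, hw⟩ := hn
  have key := Ψ.propagate (Q := fun w => ∀ γ ∈ Ψ.germs w, ∃ a : ℂ,
      γ = ((fun _ => a : M → ℂ) : Germ (𝓝 w) ℂ)) ?_
      (Ψ.notMem_sing_of_mem_germs hg) (Ψ.notMem_sing_of_mem_germs hγ) ?_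
  · obtain ⟨a, ha⟩ := key γ hγ
    exact hw a ha
  · intro x hx
    obtain ⟨V, hVo, hVc, hxV, -, hV⟩ := Ψ.continuation x hx
    have key : ∀ x ∈ V, ∀ y ∈ V, (∀ γ ∈ Ψ.germs x,
        ∃ a : ℂ, γ = ((fun _ => a : M → ℂ) : Germ (𝓝 x) ℂ)) → (∀ γ ∈ Ψ.germs y,
        ∃ a : ℂ, γ = ((fun _ => a : M → ℂ) : Germ (𝓝 y) ℂ)) := by
      intro x hx y hy h γ hγ
      obtain ⟨g, hg, rfl⟩ := hV y hy γ hγ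
      obtain ⟨a, ha⟩ := h _ (hg.2.2.2 x hx)
      refine ⟨a, Germ.coe_eq.2 ?_⟩
      exact hVc.isPreconnected.eventually_eq_const (fun _ h => hg.contMDiffAt h) hx hy
        (Germ.coe_eq.1 ha)
    filter_upwards [hVo.mem_nhds hxV] with y hy
    exact ⟨key x hxV y hy, key y hy x hxV⟩
  · intro γ hγ
    obtain ⟨a, ha⟩ := hA z γ hγ _ hg
    refine ⟨c + a, ?_⟩
    rw [ha, Germ.coe_eq.2 hc]
    rfl

end MultivaluedFunction

end Multivalued

/-! ### From additively automorphic graphs to foliations -/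

section LocalBranches

variable {M : Type*} [TopologicalSpace M] [ChartedSpace ℂ M]
/-- The shear `(z, t) ↦ (φ z, t - g z)`, where `φ` is the chart of `M` at `p`, from a subset of
`V × ℂ` onto the bidisc of radii `r` and `1` around `(φ p, b)`. -/
noncomputable def shearChart (p : M) (g : M → ℂ) (V : Set M)
    (hg : ContinuousOn g V) (r : ℝ) (b : ℂ)
    (hr : Metric.ball (chartAt ℂ p p) r ⊆ (chartAt ℂ p).target ∩ (chartAt ℂ p).symm ⁻¹' V) :
    OpenPartialHomeomorph (M × ℂ) (ℂ × ℂ) where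
  toFun x := (chartAt ℂ p x.1, x.2 - g x.1)
  invFun y := ((chartAt ℂ p).symm y.1, y.2 + g ((chartAt ℂ p).symm y.1))
  source := {x | x.1 ∈ (chartAt ℂ p).source ∧ chartAt ℂ p x.1 ∈ Metric.ball (chartAt ℂ p p) r ∧
    x.2 - g x.1 ∈ Metric.ball b 1}
  target := Metric.ball (chartAt ℂ p p) r ×ˢ Metric.ball b 1
  map_source' := fun x hx => ⟨hx.2.1, hx.2.2⟩
  map_target' := by
    rintro ⟨y, s⟩ ⟨hy, hs⟩
    have h := (hr hy).1
    exact ⟨(chartAt ℂ p).map_target h, by simpa [(chartAt ℂ p).right_inv h] using hy,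
      by simpa using hs⟩
  left_inv' := by
    rintro ⟨z, t⟩ ⟨h1, h2, h3⟩
    simp [(chartAt ℂ p).left_inv h1]
  right_inv' := by
    rintro ⟨y, s⟩ ⟨hy, hs⟩
    have h := (hr hy).1
    simp [(chartAt ℂ p).right_inv h]
  open_source := by
    have hU : IsOpen ((chartAt ℂ p).source ∩ chartAt ℂ p ⁻¹' Metric.ball (chartAt ℂ p p) r) :=
      (chartAt ℂ p).isOpen_inter_preimage Metric.isOpen_ball
    have hUV : (chartAt ℂ p).source ∩ chartAt ℂ p ⁻¹' Metric.ball (chartAt ℂ p p) r ⊆ V := by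
      rintro z ⟨h1, h2⟩
      have := (hr h2).2
      rwa [mem_preimage, (chartAt ℂ p).left_inv h1] at this
    have hc : ContinuousOn (fun x : M × ℂ => x.2 - g x.1) (Prod.fst ⁻¹' ((chartAt ℂ p).source ∩
        chartAt ℂ p ⁻¹' Metric.ball (chartAt ℂ p p) r)) :=
      continuousOn_snd.sub ((hg.mono hUV).comp continuousOn_fst fun x hx => hx)
    have := hc.isOpen_inter_preimage (hU.preimage continuous_fst)
      (Metric.isOpen_ball (x := b) (ε := 1))
    convert this using 1
    ext x
    simp [and_assoc]
  open_target := Metric.isOpen_ball.prod Metric.isOpen_ball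
  continuousOn_toFun := by
    have hUV : ∀ x : M × ℂ, x.1 ∈ (chartAt ℂ p).source ∧ chartAt ℂ p x.1 ∈
        Metric.ball (chartAt ℂ p p) r ∧ x.2 - g x.1 ∈ Metric.ball b 1 → x.1 ∈ V := by
      rintro x ⟨h1, h2, -⟩
      have := (hr h2).2
      rwa [mem_preimage, (chartAt ℂ p).left_inv h1] at this
    exact ((chartAt ℂ p).continuousOn.comp continuousOn_fst fun x hx => hx.1).prodMk
      (continuousOn_snd.sub (hg.comp continuousOn_fst fun x hx => hUV x hx))
  continuousOn_invFun := by
    have h1 : ContinuousOn (fun y : ℂ × ℂ => (chartAt ℂ p).symm y.1)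
        (Metric.ball (chartAt ℂ p p) r ×ˢ Metric.ball b 1) :=
      (chartAt ℂ p).symm.continuousOn.comp continuousOn_fst fun y hy => (hr hy.1).1
    exact h1.prodMk (continuousOn_snd.add (hg.comp h1 fun y hy => (hr hy.1).2))

variable {R : Type*} [TopologicalSpace R]

/-- Near the point `p`, the curve `ι : R → M × ℂ` runs in the graph of the function `g`, which is
holomorphic at the projection of `p` to `M`. -/
def IsLocalBranchAt (ι : R → M × ℂ) (p : R) (g : M → ℂ) : Prop :=
  ContMDiffAt 𝓘(ℂ) 𝓘(ℂ) ω g (ι p).1 ∧ ∀ᶠ q in 𝓝 p, (ι q).2 = g (ι q).1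

theorem IsLocalBranchAt.apply_eq {ι : R → M × ℂ} {p : R} {g : M → ℂ}
    (h : IsLocalBranchAt ι p g) : (ι p).2 = g (ι p).1 := h.2.self_of_nhds

variable {ι : R → M × ℂ} {Ψ : MultivaluedFunction M}

theorem mem_range_tTranslate {M R : Type*} {ι : R → M × ℂ} {c : ℂ} {x : M × ℂ} :
    x ∈ range (tTranslate ι c) ↔ (x.1, x.2 - c) ∈ range ι := by
  constructor
  · rintro ⟨p, rfl⟩
    exact ⟨p, by simp [tTranslate]⟩
  · rintro ⟨p, hp⟩
    exact ⟨p, by simp [tTranslate, hp]⟩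

theorem IsGraphOf.exists_isLocalBranchAt (hG : IsGraphOf ι Ψ) (p : R) :
    ∃ g : M → ℂ, (g : Germ (𝓝 (ι p).1) ℂ) ∈ Ψ.germs (ι p).1 ∧ IsLocalBranchAt ι p g := by
  obtain ⟨g, hg, hp⟩ := hG.1 p
  exact ⟨g, hg, Ψ.contMDiffAt_of_mem_germs hg, hp⟩

theorem IsGraphOf.mem_range_iff (hG : IsGraphOf ι Ψ) {z : M} {t : ℂ} :
    (z, t) ∈ range ι ↔ ∃ g : M → ℂ, (g : Germ (𝓝 z) ℂ) ∈ Ψ.germs z ∧ g z = t := by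
  constructor
  · rintro ⟨p, hp⟩
    obtain ⟨g, hg, hl⟩ := hG.exists_isLocalBranchAt p
    have := hl.apply_eq
    rw [hp] at hg this
    exact ⟨g, hg, this.symm⟩
  · rintro ⟨g, hg, rfl⟩
    exact hG.2 z _ hg

theorem IsGraphOf.fst_notMem_sing (hG : IsGraphOf ι Ψ) (p : R) : (ι p).1 ∉ Ψ.sing := by
  obtain ⟨g, hg, -⟩ := hG.1 p
  exact Ψ.notMem_sing_of_mem_germs hg

/-- Two branches of an additively automorphic function differ by the difference of their values. -/
theorem MultivaluedFunction.AdditivelyAutomorphic.eventuallyEq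
    (hA : Ψ.AdditivelyAutomorphic) {z : M} {g h : M → ℂ} (hg : (g : Germ (𝓝 z) ℂ) ∈ Ψ.germs z)
    (hh : (h : Germ (𝓝 z) ℂ) ∈ Ψ.germs z) : g =ᶠ[𝓝 z] fun w => h w + (g z - h z) := by
  obtain ⟨a, ha⟩ := hA z _ hg _ hh
  have h1 := germ_add_const_eq_iff.1 ha
  have h2 : g z = h z + a := h1.self_of_nhds
  filter_upwards [h1] with w hw
  rw [hw, h2]; ring

/-- For an additively automorphic function, a point belongs to the graph exactly when the
corresponding translate of a given branch is a branch. -/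
theorem IsGraphOf.mem_range_iff_germ (hG : IsGraphOf ι Ψ) (hA : Ψ.AdditivelyAutomorphic) {z : M}
    {g : M → ℂ} (hg : (g : Germ (𝓝 z) ℂ) ∈ Ψ.germs z) (d : ℂ) :
    (z, g z + d) ∈ range ι ↔ ((fun w => g w + d : M → ℂ) : Germ (𝓝 z) ℂ) ∈ Ψ.germs z := by
  rw [hG.mem_range_iff]
  constructor
  · rintro ⟨h, hh, he⟩
    have := hA.eventuallyEq hh hg
    rw [he, add_sub_cancel_left] at this
    rwa [← Germ.coe_eq.2 this]
  · intro h
    exact ⟨_, h, rfl⟩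

theorem IsGraphOf.translatesUnion_eq (hG : IsGraphOf ι Ψ) :
    translatesUnion ι = Prod.fst ⁻¹' Ψ.singᶜ := by
  ext ⟨z, t⟩
  simp only [translatesUnion, mem_iUnion, mem_range_tTranslate, mem_preimage]
  constructor
  · rintro ⟨c, p, hp⟩
    have := hG.fst_notMem_sing p
    rwa [hp] at this
  · intro hz
    obtain ⟨g, hg⟩ := Ψ.exists_germ hz
    exact ⟨t - g z, hG.mem_range_iff.2 ⟨g, hg, by ring⟩⟩

variable [ChartedSpace ℂ R]

theorem IsInjectiveImmersion.contMDiff_fst {ι : R → M × ℂ} (hι : IsInjectiveImmersion ι) :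
    ContMDiff 𝓘(ℂ) 𝓘(ℂ) ω fun q => (ι q).1 :=
  _root_.contMDiff_fst.comp hι.holomorphic

theorem IsInjectiveImmersion.contMDiff_snd {ι : R → M × ℂ} (hι : IsInjectiveImmersion ι) :
    ContMDiff 𝓘(ℂ) 𝓘(ℂ) ω fun q => (ι q).2 :=
  _root_.contMDiff_snd.comp hι.holomorphic

variable [IsManifold 𝓘(ℂ) ω M]

/-- Where the curve is a graph, its projection to `M` is open: it is not constant, because the curve
is injectively immersed. -/
theorem IsLocalBranchAt.nhds_le_map [IsManifold 𝓘(ℂ) ω R] (hι : IsInjectiveImmersion ι) {p : R}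
    {g : M → ℂ} (h : IsLocalBranchAt ι p g) : 𝓝 (ι p).1 ≤ map (fun q => (ι q).1) (𝓝 p) := by
  refine (eventually_const_or_nhds_le_map (hι.contMDiff_fst p)).resolve_left fun hc => ?_
  have := nhdsNE_neBot_of_chartedSpace p
  have h1 : ∀ᶠ q in 𝓝[≠] p, q ≠ p ∧ ι q = ι p := by
    filter_upwards [self_mem_nhdsWithin, hc.filter_mono nhdsWithin_le_nhds,
      h.2.filter_mono nhdsWithin_le_nhds] with q h1 h2 h3
    exact ⟨h1, Prod.ext h2 (by rw [h3, h2, h.apply_eq])⟩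
  obtain ⟨q, hq1, hq2⟩ := h1.exists
  exact hq1 (hι.injective hq2)

theorem IsLocalBranchAt.eventuallyEq [IsManifold 𝓘(ℂ) ω R] (hι : IsInjectiveImmersion ι) {p : R}
    {g h : M → ℂ} (hg : IsLocalBranchAt ι p g) (hh : IsLocalBranchAt ι p h) :
    g =ᶠ[𝓝 (ι p).1] h := by
  refine hg.nhds_le_map hι (mem_map.2 ?_)
  filter_upwards [hg.2, hh.2] with q h1 h2
  exact h1.symm.trans h2

/-- If a translate of a branch on `V` is a branch near one point of `V`, it is one near every
point. -/
theorem MultivaluedFunction.add_const_mem_germs_of_isBranchOn (Ψ : MultivaluedFunction M)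
    {V : Set M} (hV : ∀ w ∈ V, ∀ γ ∈ Ψ.germs w, ∃ g : M → ℂ, IsBranchOn Ψ.germs V g ∧
      (g : Germ (𝓝 w) ℂ) = γ) {g : M → ℂ} (hg : IsBranchOn Ψ.germs V g) {d : ℂ} {x y : M}
    (hx : x ∈ V) (hy : y ∈ V)
    (h : ((fun w => g w + d : M → ℂ) : Germ (𝓝 x) ℂ) ∈ Ψ.germs x) :
    ((fun w => g w + d : M → ℂ) : Germ (𝓝 y) ℂ) ∈ Ψ.germs y := by
  obtain ⟨k, hk, he⟩ := hV x hx _ h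
  have h1 := hg.2.1.isPreconnected.eventuallyEq_add_const (fun _ h => hk.contMDiffAt h)
    (fun _ h => hg.contMDiffAt h) hx hy (Germ.coe_eq.1 he)
  have h2 := hk.2.2.2 y hy
  rwa [Germ.coe_eq.2 h1] at h2

/-- A translate of the graph of an additively automorphic function is contained in every other one
that it meets. -/
theorem IsGraphOf.range_tTranslate_subset [ConnectedSpace R] (hι : IsInjectiveImmersion ι)
    (hG : IsGraphOf ι Ψ)
    (hA : Ψ.AdditivelyAutomorphic) {i j : ℂ}
    (h : (range (tTranslate ι i) ∩ range (tTranslate ι j)).Nonempty) :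
    range (tTranslate ι i) ⊆ range (tTranslate ι j) := by
  obtain ⟨x, ⟨p, rfl⟩, hp⟩ := h
  rintro _ ⟨q, rfl⟩
  -- membership of the translated point in the other leaf is locally constant along `R`
  refine ((isPreconnected_univ (α := R)).induction₂
    (fun x y => tTranslate ι i x ∈ range (tTranslate ι j) ↔
      tTranslate ι i y ∈ range (tTranslate ι j)) ?_
    (fun _ _ _ _ _ _ => Iff.trans) (fun _ _ _ _ => Iff.symm) (mem_univ p) (mem_univ q)).1 hp
  intro x _
  rw [nhdsWithin_univ]
  obtain ⟨g, hg, hl⟩ := hG.exists_isLocalBranchAt x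
  obtain ⟨V, hVo, hVc, hxV, -, hV⟩ := Ψ.continuation _ (hG.fst_notMem_sing x)
  obtain ⟨k, hk, he⟩ := hV _ hxV _ hg
  have hkl : ∀ᶠ q in 𝓝 x, (ι q).2 = k (ι q).1 := by
    filter_upwards [hl.2, (hι.contMDiff_fst x).continuousAt.eventually (Germ.coe_eq.1 he)]
      with q h1 h2
    rw [h1, h2]
  have key : ∀ y, (ι y).1 ∈ V → (ι y).2 = k (ι y).1 →
      (tTranslate ι i y ∈ range (tTranslate ι j) ↔
        ((fun w => k w + (i - j) : M → ℂ) : Germ (𝓝 (ι y).1) ℂ) ∈ Ψ.germs (ι y).1) := by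
    intro y hy hy2
    rw [mem_range_tTranslate, ← hG.mem_range_iff_germ hA (hk.2.2.2 _ hy)]
    simp only [tTranslate, hy2, add_sub_assoc]
  filter_upwards [hkl, (hι.contMDiff_fst x).continuousAt (hVo.mem_nhds hxV)] with y hy hyV
  rw [key x hxV hkl.self_of_nhds, key y hyV hy]
  exact ⟨Ψ.add_const_mem_germs_of_isBranchOn hV hk hxV hyV,
    Ψ.add_const_mem_germs_of_isBranchOn hV hk hyV hxV⟩

/-- The shear along a branch `g` is a foliated chart: on it every other branch is a translate of
`g`. -/
theorem IsGraphOf.exists_isFoliatedChart (hι : IsInjectiveImmersion ι) (hG : IsGraphOf ι Ψ)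
    (hA : Ψ.AdditivelyAutomorphic) {q : M × ℂ} (hq : q.1 ∉ Ψ.sing) :
    ∃ e : OpenPartialHomeomorph (M × ℂ) (ℂ × ℂ), q ∈ e.source ∧
      e.source ⊆ Prod.fst ⁻¹' Ψ.singᶜ ∧ IsFoliatedChart (tTranslate ι) e := by
  obtain ⟨g₀, hg₀⟩ := Ψ.exists_germ hq
  obtain ⟨V, hVo, hVc, hxV, hVs, hV⟩ := Ψ.continuation _ hq
  obtain ⟨g, hg, -⟩ := hV _ hxV _ hg₀
  have hp := mem_chart_source ℂ q.1
  have hn : (chartAt ℂ q.1).target ∩ (chartAt ℂ q.1).symm ⁻¹' V ∈ 𝓝 (chartAt ℂ q.1 q.1) := by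
    refine inter_mem (chart_target_mem_nhds ℂ q.1) ?_
    rw [← mem_map, map_chart_symm_nhds hp]
    exact hVo.mem_nhds hxV
  obtain ⟨r, hr0, hr⟩ := Metric.mem_nhds_iff.1 hn
  set e := shearChart q.1 g V hg.2.2.1.continuousOn r (q.2 - g q.1) hr with he
  have hsV : ∀ x ∈ e.source, x.1 ∈ V := by
    rintro x ⟨h1, h2, -⟩
    have := (hr h2).2
    rwa [mem_preimage, (chartAt ℂ q.1).left_inv h1] at this
  refine ⟨e, ⟨hp, Metric.mem_ball_self hr0, Metric.mem_ball_self one_pos⟩,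
    fun x hx => hVs (hsV x hx), ?_, ?_, ⟨_, _, r, 1, hr0, one_pos, rfl⟩, ?_, ?_⟩
  · intro x hx
    refine ContMDiffAt.contMDiffWithinAt ?_
    have h1 : ContMDiffAt (𝓘(ℂ).prod 𝓘(ℂ)) 𝓘(ℂ) ω (fun x : M × ℂ => chartAt ℂ q.1 x.1) x :=
      (contMDiffAt_chartAt_of_mem hx.1).comp x contMDiffAt_fst
    have h2 : ContMDiffAt (𝓘(ℂ).prod 𝓘(ℂ)) 𝓘(ℂ) ω (fun x : M × ℂ => x.2 - g x.1) x :=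
      contMDiffAt_snd.sub ((hg.contMDiffAt (hsV x hx)).comp x contMDiffAt_fst)
    exact h1.prodMk_space h2
  · intro y hy
    refine ContMDiffAt.contMDiffWithinAt ?_
    have hyt : y.1 ∈ (chartAt ℂ q.1).target := (hr hy.1).1
    have h0 : ContMDiffAt 𝓘(ℂ, ℂ × ℂ) 𝓘(ℂ) ω (fun y : ℂ × ℂ => y.1) y :=
      contDiffAt_fst.contMDiffAt
    have h0' : ContMDiffAt 𝓘(ℂ, ℂ × ℂ) 𝓘(ℂ) ω (fun y : ℂ × ℂ => y.2) y :=
      contDiffAt_snd.contMDiffAt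
    have h1 : ContMDiffAt 𝓘(ℂ, ℂ × ℂ) 𝓘(ℂ) ω (fun y : ℂ × ℂ => (chartAt ℂ q.1).symm y.1) y :=
      (contMDiffOn_chart_symm.contMDiffAt
        ((chartAt ℂ q.1).open_target.mem_nhds hyt)).comp y h0
    have h2 : ContMDiffAt 𝓘(ℂ, ℂ × ℂ) 𝓘(ℂ) ω
        (fun y : ℂ × ℂ => y.2 + g ((chartAt ℂ q.1).symm y.1)) y :=
      h0'.add ((hg.contMDiffAt (hr hy.1).2).comp y h1)
    exact h1.prodMk h2
  · intro j p hp
    obtain ⟨h, hh, hl⟩ := hG.exists_isLocalBranchAt p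
    have hpV : (ι p).1 ∈ V := hsV (tTranslate ι j p) hp
    have h1 := hA.eventuallyEq hh (hg.2.2.2 _ hpV)
    filter_upwards [hl.2, (hι.contMDiff_fst p).continuousAt.eventually h1] with x hx hx2
    have hx3 := hl.apply_eq
    change (ι x).2 + j - g (ι x).1 = (ι p).2 + j - g (ι p).1
    rw [hx, hx2, hx3]
    ring
  · intro y
    refine ⟨y, ?_⟩
    rintro x ⟨hx, hxy⟩
    rw [mem_range_tTranslate, hG.mem_range_iff]
    refine ⟨g, hg.2.2.2 _ (hsV x hx), ?_⟩
    rw [← hxy]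
    change g x.1 = x.2 - (x.2 - g x.1)
    ring

/-- The graph of a nonconstant additively automorphic function and its translates form a foliation
without horizontal plaques. -/
theorem IsAdditivelyAutomorphicGraph.translatesFoliate [IsManifold 𝓘(ℂ) ω R]
    [ConnectedSpace R]
    (hι : IsInjectiveImmersion ι) (h : IsAdditivelyAutomorphicGraph ι) :
    TranslatesFoliate ι := by
  obtain ⟨Ψ, hA, hN, hG⟩ := h
  refine ⟨⟨?_, rfl, ?_, ?_⟩, ?_, ?_⟩
  · rw [hG.translatesUnion_eq]
    exact Ψ.isClosed_sing.isOpen_compl.preimage continuous_fst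
  · intro i j hij
    exact (hG.range_tTranslate_subset hι hA hij).antisymm
      (hG.range_tTranslate_subset hι hA (by rwa [inter_comm]))
  · rw [hG.translatesUnion_eq]
    intro q hq
    exact hG.exists_isFoliatedChart hι hA hq
  · rw [hG.translatesUnion_eq, image_preimage_eq _ Prod.fst_surjective, compl_compl]
    exact Ψ.countable_sing
  · rintro c ⟨W, V, t, hW, hV, ⟨z, hz⟩, hWV⟩
    obtain ⟨p, hpW, hp⟩ : (z, t) ∈ tTranslate ι c '' W := hWV ▸ ⟨hz, rfl⟩
    obtain ⟨g, hg, hl⟩ := hG.exists_isLocalBranchAt p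
    refine Ψ.not_eventually_const hA hN hg (t - c) (hl.nhds_le_map hι ?_)
    rw [mem_map]
    filter_upwards [hl.2, hW.mem_nhds hpW] with q h1 h2
    have h3 : (tTranslate ι c q).2 = t := by
      have : tTranslate ι c q ∈ V ×ˢ {t} := hWV ▸ mem_image_of_mem _ h2
      exact this.2
    change g (ι q).1 = t - c
    rw [← h1, ← h3]
    simp [tTranslate]

end LocalBranches

/-! ### From foliations to additively automorphic graphs -/

section Foliations

theorem tTranslate_zero {M R : Type*} (ι : R → M × ℂ) : tTranslate ι 0 = ι := by
  funext p
  simp [tTranslate]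

variable {M : Type*} [TopologicalSpace M] [ChartedSpace ℂ M]
variable {R : Type*} [TopologicalSpace R] {ι : R → M × ℂ}

/-- The translation that moves one point of the curve to another one over the same point of `M`
preserves the curve. -/
theorem TranslatesFoliate.range_tTranslate_eq (h : TranslatesFoliate ι) {p p' : R}
    (hp : (ι p).1 = (ι p').1) : range (tTranslate ι ((ι p').2 - (ι p).2)) = range ι := by
  have h1 := h.1.eq_of_meet ((ι p').2 - (ι p).2) 0 ⟨ι p', ⟨p, Prod.ext hp (by simp [tTranslate])⟩,
    ⟨p', by rw [tTranslate_zero]⟩⟩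
  rwa [tTranslate_zero] at h1

variable [ChartedSpace ℂ R]

theorem IsInjectiveImmersion.contMDiff_tTranslate (hι : IsInjectiveImmersion ι) (c : ℂ) :
    ContMDiff 𝓘(ℂ) (𝓘(ℂ).prod 𝓘(ℂ)) ω (tTranslate ι c) :=
  hι.contMDiff_fst.prodMk (hι.contMDiff_snd.add contMDiff_const)

theorem IsInjectiveImmersion.injective_tTranslate (hι : IsInjectiveImmersion ι) (c : ℂ) :
    Function.Injective (tTranslate ι c) := by
  intro p q h
  refine hι.injective (Prod.ext (congrArg Prod.fst h :) ?_)
  exact add_right_cancel (congrArg Prod.snd h)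

/-- At a point where the projection of an immersed curve to `M` is critical, the projection to `ℂ`
is not. -/
theorem IsInjectiveImmersion.dAt_snd_ne_zero [IsManifold 𝓘(ℂ) ω M] (hι : IsInjectiveImmersion ι)
    {p : R}
    (h : dAt (chartAt ℂ (ι p).1 ∘ fun q => (ι q).1) p = 0) : dAt (fun q => (ι q).2) p ≠ 0 := by
  intro h2
  have hd1 : MDifferentiableAt 𝓘(ℂ) 𝓘(ℂ) (fun q => (ι q).1) p :=
    (hι.contMDiff_fst p).mdifferentiableAt (by simp)
  have hd2 : MDifferentiableAt 𝓘(ℂ) 𝓘(ℂ) (fun q => (ι q).2) p :=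
    (hι.contMDiff_snd p).mdifferentiableAt (by simp)
  have hz := mem_chart_source ℂ (ι p).1
  have h3 : mfderiv 𝓘(ℂ) (𝓘(ℂ).prod 𝓘(ℂ)) ι p = _ := mfderiv_prodMk hd1 hd2
  have h4 := mfderiv_comp (I'' := 𝓘(ℂ)) p (g := chartAt ℂ (ι p).1) (f := fun q => (ι q).1)
    ((contMDiffAt_chartAt_of_mem hz).mdifferentiableAt (by simp)) hd1
  have h5 : (mfderiv 𝓘(ℂ) 𝓘(ℂ) (fun q => (ι q).1) p (1 : ℂ) : ℂ) = 0 := by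
    have h6 : (show ℂ from mfderiv 𝓘(ℂ) 𝓘(ℂ) (fun q => (ι q).1) p (1 : ℂ)) *
        dAt (chartAt ℂ (ι p).1) (ι p).1 = 0 := by
      rw [← mfderiv_apply_eq_mul, ← h]
      unfold dAt
      rw [h4]
      rfl
    exact (mul_eq_zero.1 h6).resolve_right (dAt_chart_ne_zero hz)
  have h6 : mfderiv 𝓘(ℂ) (𝓘(ℂ).prod 𝓘(ℂ)) ι p (1 : ℂ) =
      mfderiv 𝓘(ℂ) (𝓘(ℂ).prod 𝓘(ℂ)) ι p (0 : ℂ) := by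
    have h7 : mfderiv 𝓘(ℂ) (𝓘(ℂ).prod 𝓘(ℂ)) ι p (1 : ℂ) = ((0 : ℂ), (0 : ℂ)) := by
      rw [h3]
      exact Prod.ext h5 h2
    rw [h7]
    exact ((mfderiv 𝓘(ℂ) (𝓘(ℂ).prod 𝓘(ℂ)) ι p).map_zero).symm
  exact one_ne_zero (α := ℂ) (hι.immersion p h6)

/-- In a foliated chart, a piece of a leaf around a point contains the part of the plaque near this
point: the leaf runs in the plaque, injectively, so its plaque coordinate is an open map. -/
theorem IsFoliatedChart.exists_nhds_subset_image [IsManifold 𝓘(ℂ) ω R]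
    (hι : IsInjectiveImmersion ι)
    {e : OpenPartialHomeomorph (M × ℂ) (ℂ × ℂ)} (he : IsFoliatedChart (tTranslate ι) e) {c : ℂ}
    {p : R} (hp : tTranslate ι c p ∈ e.source) {N : Set R} (hN : N ∈ 𝓝 p) :
    ∀ᶠ x in 𝓝 (tTranslate ι c p), (e x).2 = (e (tTranslate ι c p)).2 →
      x ∈ tTranslate ι c '' N := by
  set l := tTranslate ι c with hl
  have hlc := hι.contMDiff_tTranslate c
  have h1 : ContMDiffAt 𝓘(ℂ) 𝓘(ℂ, ℂ × ℂ) ω (fun q => e (l q)) p :=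
    ((he.holomorphic.contMDiffAt (e.open_source.mem_nhds hp))).comp p (hlc p)
  have hu : ContMDiffAt 𝓘(ℂ) 𝓘(ℂ) ω (fun q => (e (l q)).1) p :=
    contDiffAt_fst.contMDiffAt.comp p h1
  have hsrc : ∀ᶠ q in 𝓝 p, l q ∈ e.source :=
    hlc.continuous.continuousAt (e.open_source.mem_nhds hp)
  have hconst := he.locally_const c p hp
  have hopen : 𝓝 (e (l p)).1 ≤ map (fun q => (e (l q)).1) (𝓝 p) := by
    refine (eventually_const_or_nhds_le_map hu).resolve_left fun hc => ?_
    have := nhdsNE_neBot_of_chartedSpace p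
    have h2 : ∀ᶠ q in 𝓝[≠] p, q ≠ p ∧ l q = l p := by
      filter_upwards [self_mem_nhdsWithin, hc.filter_mono nhdsWithin_le_nhds,
        hsrc.filter_mono nhdsWithin_le_nhds, hconst.filter_mono nhdsWithin_le_nhds]
        with q h1 h2 h3 h4
      exact ⟨h1, e.injOn h3 hp (Prod.ext h2 h4)⟩
    obtain ⟨q, hq1, hq2⟩ := h2.exists
    exact hq1 (hι.injective_tTranslate c hq2)
  have hN' : N ∩ {q | l q ∈ e.source ∧ (e (l q)).2 = (e (l p)).2} ∈ 𝓝 p :=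
    inter_mem hN (hsrc.and hconst)
  have h3 := hopen (image_mem_map hN')
  have h4 : ContinuousAt (fun x => (e x).1) (l p) :=
    continuousAt_fst.comp (e.continuousAt hp)
  filter_upwards [h4 h3, e.open_source.mem_nhds hp] with x hx hxs hx2
  obtain ⟨q, ⟨hqN, hq1, hq2⟩, hq3⟩ := hx
  exact ⟨q, hqN, e.injOn hq1 hxs (Prod.ext hq3 (hq2.trans hx2.symm))⟩

/-- A translation that preserves the image of the curve maps local branches to local branches. The
foliation is needed to see that it is continuous for the topology of the curve. -/
theorem TranslatesFoliate.exists_isLocalBranchAt_add [IsManifold 𝓘(ℂ) ω R]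
    (hι : IsInjectiveImmersion ι) (h : TranslatesFoliate ι) {d : ℂ}
    (hd : range (tTranslate ι d) = range ι) {q : R} {g : M → ℂ}
    (hg : IsLocalBranchAt ι q g) :
    ∃ q', ι q' = tTranslate ι d q ∧ IsLocalBranchAt ι q' fun w => g w + d := by
  obtain ⟨q', hq'⟩ : tTranslate ι d q ∈ range ι := hd ▸ mem_range_self q
  have h1 : (ι q').1 = (ι q).1 := (congrArg Prod.fst hq' :)
  have h2 : (ι q').2 = (ι q).2 + d := (congrArg Prod.snd hq' :)
  refine ⟨q', hq', ?_, ?_⟩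
  · rw [h1]; exact hg.1.add contMDiffAt_const
  · -- near `q'`, the translate by `-d` runs in the plaque of `ι q`, hence in the curve near `q`
    have hqt : tTranslate ι (-d) q' = ι q := Prod.ext h1 (by simp [tTranslate, h2])
    obtain ⟨e, hpe, -, he⟩ := h.1.exists_chart (ι q)
      (mem_iUnion.2 ⟨0, q, by rw [tTranslate_zero]⟩)
    have h3 := he.exists_nhds_subset_image hι (c := 0) (p := q) (by rwa [tTranslate_zero]) hg.2
    rw [tTranslate_zero] at h3
    have h4 := he.locally_const (-d) q' (by rwa [hqt])
    have h5 := (hι.contMDiff_tTranslate (-d)).continuous.continuousAt (x := q')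
    rw [ContinuousAt, hqt] at h5
    rw [hqt] at h4
    filter_upwards [h4, h5.eventually h3] with r hr hr2
    obtain ⟨s, hs, hs2⟩ := hr2 hr
    have h6 : (ι s).2 = g (ι s).1 := hs
    rw [hs2] at h6
    simp only [tTranslate] at h6
    rw [← h6]
    ring

variable [IsManifold 𝓘(ℂ) ω M] [IsManifold 𝓘(ℂ) ω R]

/-- The inverse function theorem for holomorphic maps between complex curves. -/
theorem ContMDiffAt.exists_local_inverse {f : R → M} {p : R}
    (hf : ContMDiffAt 𝓘(ℂ) 𝓘(ℂ) ω f p) (hd : dAt (chartAt ℂ (f p) ∘ f) p ≠ 0) :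
    ∃ σ : M → R, ContMDiffAt 𝓘(ℂ) 𝓘(ℂ) ω σ (f p) ∧ σ (f p) = p ∧
      (∀ᶠ z in 𝓝 (f p), f (σ z) = z) ∧ ∀ᶠ q in 𝓝 p, σ (f q) = q := by
  set φ := chartAt ℂ (f p) with hφ
  set ψ := chartAt ℂ p with hψ
  have hp : p ∈ ψ.source := mem_chart_source ℂ p
  have hfp : f p ∈ φ.source := mem_chart_source ℂ (f p)
  have hk : ContMDiffAt 𝓘(ℂ) 𝓘(ℂ) ω (φ ∘ f) p := (contMDiffAt_chartAt_of_mem hfp).comp p hf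
  have hK := analyticAt_comp_chart_symm hp hk
  set K := (φ ∘ f) ∘ ψ.symm with hKdef
  have hKp : K (ψ p) = φ (f p) := by simp [hKdef, ψ.left_inv hp]
  have hd' : deriv K (ψ p) ≠ 0 := by
    intro h0
    rw [dAt_eq_deriv_mul hp hk, h0, zero_mul] at hd
    exact hd rfl
  have hst := hK.hasStrictDerivAt
  have hK' := hK.differentiableAt.hasDerivAt.hasFDerivAt_equiv hd'
  have hKc : ContDiffAt ℂ ω K (ψ p) := hK.contDiffAt
  have hs := hKc.hasStrictFDerivAt' hK' (by simp)
  set F := hKc.localInverse hK' (by simp) with hF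
  have hFc : ContDiffAt ℂ ω F (K (ψ p)) := hKc.to_localInverse hK' (by simp)
  have hl : ∀ᶠ x in 𝓝 (ψ p), F (K x) = x := hs.eventually_left_inverse
  have hr : ∀ᶠ x in 𝓝 (K (ψ p)), K (F x) = x := hs.eventually_right_inverse
  have hFp : F (K (ψ p)) = ψ p := hl.self_of_nhds
  rw [hKp] at hFc hr hFp
  have h1 : ContMDiffAt 𝓘(ℂ) 𝓘(ℂ) ω (F ∘ φ) (f p) :=
    (contMDiffAt_iff_contDiffAt.2 hFc).comp (f p) (contMDiffAt_chartAt_of_mem hfp)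
  have h2 : ContMDiffAt 𝓘(ℂ) 𝓘(ℂ) ω ψ.symm ((F ∘ φ) (f p)) := by
    simp only [Function.comp_apply, hFp]
    exact contMDiffOn_chart_symm.contMDiffAt (chart_target_mem_nhds ℂ p)
  have h3 : ContMDiffAt 𝓘(ℂ) 𝓘(ℂ) ω (ψ.symm ∘ (F ∘ φ)) (f p) := h2.comp (f p) h1
  have hσp : (ψ.symm ∘ (F ∘ φ)) (f p) = p := by simp [hFp, ψ.left_inv hp]
  refine ⟨ψ.symm ∘ (F ∘ φ), h3, hσp, ?_, ?_⟩
  · have h4 : ∀ᶠ z in 𝓝 (f p), f ((ψ.symm ∘ (F ∘ φ)) z) ∈ φ.source := by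
      have hc : ContinuousAt (fun z => f ((ψ.symm ∘ (F ∘ φ)) z)) (f p) := by
        refine ContinuousAt.comp (g := f) ?_ h3.continuousAt
        rw [hσp]; exact hf.continuousAt
      have := hc.preimage_mem_nhds (t := φ.source) (by
        rw [hσp]; exact chart_source_mem_nhds ℂ (f p))
      exact this
    have h5 : ∀ᶠ z in 𝓝 (f p), K (F (φ z)) = φ z := (φ.continuousAt hfp).eventually hr
    filter_upwards [h4, h5, chart_source_mem_nhds ℂ (f p)] with z h6 h7 h8
    exact φ.injOn h6 h8 h7
  · have h4 : ∀ᶠ q in 𝓝 p, F (K (ψ q)) = ψ q := (ψ.continuousAt hp).eventually hl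
    filter_upwards [h4, chart_source_mem_nhds ℂ p] with q h5 h6
    simp only [hKdef, Function.comp_apply, ψ.left_inv h6] at h5
    simp only [Function.comp_apply, h5, ψ.left_inv h6]

/-- If the leaves of a foliation are the translates of a curve, and the curve is vertical at a
point, then the plaque of this point contains a vertical disc: all translates are vertical at the
translates of the point, so the differential of the second coordinate of a foliated chart kills
`∂/∂t` along the vertical line. -/
theorem IsFoliatedChart.eventually_snd_eq_of_dAt_eq_zero (hι : IsInjectiveImmersion ι)
    {e : OpenPartialHomeomorph (M × ℂ) (ℂ × ℂ)} (he : IsFoliatedChart (tTranslate ι) e) {p : R}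
    (hp : ι p ∈ e.source) (h : dAt (chartAt ℂ (ι p).1 ∘ fun q => (ι q).1) p = 0) :
    ∀ᶠ t in 𝓝 (ι p).2, ((ι p).1, t) ∈ e.source ∧ (e ((ι p).1, t)).2 = (e (ι p)).2 := by
  set φ := chartAt ℂ (ι p).1 with hφ
  set ψ := chartAt ℂ p with hψ
  have hz : (ι p).1 ∈ φ.source := mem_chart_source ℂ _
  have hpψ : p ∈ ψ.source := mem_chart_source ℂ p
  have hka : ContMDiffAt 𝓘(ℂ) 𝓘(ℂ) ω (φ ∘ fun q => (ι q).1) p :=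
    (contMDiffAt_chartAt_of_mem hz).comp p (hι.contMDiff_fst p)
  set a := (φ ∘ fun q => (ι q).1) ∘ ψ.symm with ha
  set b := (fun q => (ι q).2) ∘ ψ.symm with hb
  have haA : HasDerivAt a 0 (ψ p) := by
    have h1 := (analyticAt_comp_chart_symm hpψ hka).differentiableAt.hasDerivAt
    rw [dAt_eq_deriv_mul hpψ hka] at h
    rwa [(mul_eq_zero.1 h).resolve_right (dAt_chart_ne_zero hpψ)] at h1
  have hbA : HasDerivAt b (deriv b (ψ p)) (ψ p) :=
    (analyticAt_comp_chart_symm hpψ (hι.contMDiff_snd p)).differentiableAt.hasDerivAt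
  have hb0 : deriv b (ψ p) ≠ 0 := by
    intro h0
    refine hι.dAt_snd_ne_zero h ?_
    rw [dAt_eq_deriv_mul hpψ (hι.contMDiff_snd p)]
    exact mul_eq_zero_of_left h0 _
  have hap : a (ψ p) = φ (ι p).1 := by simp [ha, ψ.left_inv hpψ]
  have hbp : b (ψ p) = (ι p).2 := by simp [hb, ψ.left_inv hpψ]
  -- the second coordinate of the foliated chart, read in the chart of `M`
  set F : ℂ × ℂ → ℂ := fun y => (e (φ.symm y.1, y.2)).2 with hF
  have hFd : ∀ t, ((ι p).1, t) ∈ e.source → DifferentiableAt ℂ F (φ (ι p).1, t) := by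
    intro t ht
    have h1 : ContMDiffAt 𝓘(ℂ, ℂ × ℂ) 𝓘(ℂ) ω (fun y : ℂ × ℂ => φ.symm y.1) (φ (ι p).1, t) :=
      (contMDiffOn_chart_symm.contMDiffAt (chart_target_mem_nhds ℂ (ι p).1)).comp
        (φ (ι p).1, t) (contDiffAt_fst (𝕜 := ℂ) (E := ℂ) (F := ℂ)).contMDiffAt
    have h2 : ContMDiffAt 𝓘(ℂ, ℂ × ℂ) (𝓘(ℂ).prod 𝓘(ℂ)) ω
        (fun y : ℂ × ℂ => (φ.symm y.1, y.2)) (φ (ι p).1, t) :=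
      h1.prodMk (contDiffAt_snd (𝕜 := ℂ) (E := ℂ) (F := ℂ)).contMDiffAt
    have h3 : ContMDiffAt 𝓘(ℂ, ℂ × ℂ) 𝓘(ℂ, ℂ × ℂ) ω
        (fun y : ℂ × ℂ => e (φ.symm y.1, y.2)) (φ (ι p).1, t) := by
      refine ContMDiffAt.comp (φ (ι p).1, t) (g := e) ?_ h2
      refine he.holomorphic.contMDiffAt (e.open_source.mem_nhds ?_)
      simpa [φ.left_inv hz] using ht
    exact (contDiffAt_snd.comp _ (contMDiffAt_iff_contDiffAt.1 h3)).differentiableAt (by simp)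
  have hF0 : ∀ t, ((ι p).1, t) ∈ e.source → HasDerivAt (fun t => F (φ (ι p).1, t)) 0 t := by
    intro t ht
    have h1 := (hFd t ht).hasFDerivAt
    have hc : HasDerivAt (fun s => (a s, b s + (t - (ι p).2))) (0, deriv b (ψ p)) (ψ p) :=
      haA.prodMk (hbA.add_const _)
    have hcp : (a (ψ p), b (ψ p) + (t - (ι p).2)) = (φ (ι p).1, t) := by
      rw [hap, hbp, add_sub_cancel]
    have h2 : HasDerivAt (F ∘ fun s => (a s, b s + (t - (ι p).2)))
        (fderiv ℂ F (φ (ι p).1, t) (0, deriv b (ψ p))) (ψ p) := by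
      refine HasFDerivAt.comp_hasDerivAt (ψ p) ?_ hc
      rwa [hcp]
    have htp : tTranslate ι (t - (ι p).2) p = ((ι p).1, t) := by simp [tTranslate]
    have hloc := he.locally_const (t - (ι p).2) p (by rwa [htp])
    have h3 : (F ∘ fun s => (a s, b s + (t - (ι p).2))) =ᶠ[𝓝 (ψ p)]
        fun _ => (e ((ι p).1, t)).2 := by
      have h4 : ∀ᶠ q in 𝓝 p, F ((φ ∘ fun q => (ι q).1) q, (ι q).2 + (t - (ι p).2)) =
          (e ((ι p).1, t)).2 := by
        filter_upwards [hloc, (hι.contMDiff_fst p).continuousAt (chart_source_mem_nhds ℂ (ι p).1)]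
          with q hq hq2
        rw [htp] at hq
        rw [← hq]
        simp only [hF, Function.comp_apply]
        rw [φ.left_inv hq2]
        rfl
      rw [← map_chart_symm_nhds hpψ, eventually_map] at h4
      exact h4
    have h5 : fderiv ℂ F (φ (ι p).1, t) (0, deriv b (ψ p)) = 0 :=
      h2.unique ((hasDerivAt_const (ψ p) _).congr_of_eventuallyEq h3)
    have h6 : HasDerivAt (fun t : ℂ => (φ (ι p).1, t)) ((0 : ℂ), (1 : ℂ)) t :=
      (hasDerivAt_const t _).prodMk (hasDerivAt_id t)
    have h7 := HasFDerivAt.comp_hasDerivAt t h1 h6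
    have h8 : deriv b (ψ p) • fderiv ℂ F (φ (ι p).1, t) ((0 : ℂ), (1 : ℂ)) = 0 := by
      rw [← map_smul, Prod.smul_mk, smul_zero, smul_eq_mul, mul_one, h5]
    rw [(smul_eq_zero.1 h8).resolve_left hb0] at h7
    exact h7
  have hsrc : ∀ᶠ t in 𝓝 (ι p).2, ((ι p).1, t) ∈ e.source := by
    have hc : ContinuousAt (fun t : ℂ => ((ι p).1, t)) (ι p).2 := by fun_prop
    exact hc (e.open_source.mem_nhds hp)
  obtain ⟨r, hr, hball⟩ := Metric.eventually_nhds_iff_ball.1 hsrc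
  filter_upwards [Metric.ball_mem_nhds _ hr] with t ht
  refine ⟨hball t ht, ?_⟩
  have h1 := Metric.isOpen_ball.is_const_of_deriv_eq_zero (𝕜 := ℂ)
    (convex_ball (ι p).2 r).isPreconnected
    (fun s hs => (hF0 s (hball s hs)).differentiableAt.differentiableWithinAt)
    (fun s hs => (hF0 s (hball s hs)).deriv) ht (Metric.mem_ball_self hr)
  simpa [hF, φ.left_inv hz] using h1

/-- The leaves of a foliation by translates are nowhere vertical. -/
theorem TranslatesFoliate.dAt_fst_ne_zero [T2Space M] [ConnectedSpace R]
    (hι : IsInjectiveImmersion ι) (h : TranslatesFoliate ι) (p : R) :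
    dAt (chartAt ℂ (ι p).1 ∘ fun q => (ι q).1) p ≠ 0 := by
  intro h0
  have hpΩ : ι p ∈ translatesUnion ι := mem_iUnion.2 ⟨0, p, by rw [tTranslate_zero]⟩
  obtain ⟨e, hpe, -, he⟩ := h.1.exists_chart _ hpΩ
  have hvert := he.eventually_snd_eq_of_dAt_eq_zero hι hpe h0
  rcases eventually_eq_or_eventually_ne (hι.contMDiff_fst p) (ι p).1 with hc | hne
  · -- a curve contained in a vertical line does not have an open union of translates
    have hall : ∀ q, (ι q).1 = (ι p).1 := fun q =>
      (isPreconnected_univ.eventually_eq_const (fun z _ => hι.contMDiff_fst z) (mem_univ p)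
        (mem_univ q) hc).self_of_nhds
    have := nhdsNE_neBot_of_chartedSpace (ι p).1
    have h1 : ContinuousAt (fun z : M => (z, (ι p).2)) (ι p).1 := by fun_prop
    have h2 : ∀ᶠ z in 𝓝 (ι p).1, (z, (ι p).2) ∈ translatesUnion ι :=
      h1 (h.1.isOpen.mem_nhds hpΩ)
    obtain ⟨z, hz1, hz2⟩ := ((h2.filter_mono nhdsWithin_le_nhds).and
      (self_mem_nhdsWithin (s := {(ι p).1}ᶜ))).exists
    obtain ⟨c, q, hq⟩ := mem_iUnion.1 hz1
    exact hz2 ((congrArg Prod.fst hq).symm.trans (hall q))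
  · -- the vertical disc in the plaque consists of points of the curve over the same point of `M`
    have h1 := he.exists_nhds_subset_image hι (c := 0) (p := p) (by rwa [tTranslate_zero])
      (eventually_nhdsWithin_iff.1 hne)
    rw [tTranslate_zero] at h1
    have h2 : ContinuousAt (fun t : ℂ => ((ι p).1, t)) (ι p).2 := by fun_prop
    obtain ⟨t, ⟨⟨ht1, ht2⟩, ht3⟩, ht4⟩ := (((hvert.and (h2.eventually h1)).filter_mono
      nhdsWithin_le_nhds).and (self_mem_nhdsWithin (s := {(ι p).2}ᶜ))).exists
    obtain ⟨q, hq, hq2⟩ := ht3 ht2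
    by_cases hqp : q = p
    · subst hqp
      exact ht4 (congrArg Prod.snd hq2).symm
    · exact hq hqp (congrArg Prod.fst hq2 :)

/-- Around each of its points, a curve whose translates are the leaves of a foliation is the graph
of a holomorphic function `g` on a connected open set `V`, parametrized by a section `σ` of the
projection to `M`. -/
theorem TranslatesFoliate.exists_section [T2Space M] [ConnectedSpace R]
    (hι : IsInjectiveImmersion ι) (h : TranslatesFoliate ι) (p : R) :
    ∃ (V : Set M) (g : M → ℂ) (σ : M → R), IsOpen V ∧ IsConnected V ∧ (ι p).1 ∈ V ∧
      ContMDiffOn 𝓘(ℂ) 𝓘(ℂ) ω g V ∧ (∀ w ∈ V, (ι (σ w)).1 = w ∧ IsLocalBranchAt ι (σ w) g) ∧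
      ∀ᶠ q in 𝓝 p, σ (ι q).1 = q := by
  obtain ⟨σ, hσ, hσp, hr, hl⟩ :=
    (hι.contMDiff_fst p).exists_local_inverse (h.dAt_fst_ne_zero hι p)
  set g : M → ℂ := fun w => (ι (σ w)).2 with hg
  have hgs : ∀ᶠ w in 𝓝 (ι p).1, ContMDiffAt 𝓘(ℂ) 𝓘(ℂ) ω g w := by
    filter_upwards [hσ.eventually_contMDiffAt] with w hw
    exact (hι.contMDiff_snd (σ w)).comp w hw
  have h1 : ∀ᶠ q in 𝓝 p, ∀ᶠ q' in 𝓝 q, (ι q').2 = g (ι q').1 := by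
    filter_upwards [hl.eventually_nhds] with q hq
    filter_upwards [hq] with q' hq'
    simp only [hg, hq']
  have h2 : ∀ᶠ w in 𝓝 (ι p).1, ∀ᶠ q' in 𝓝 (σ w), (ι q').2 = g (ι q').1 := by
    have hc := hσ.continuousAt
    simp only [ContinuousAt, hσp] at hc
    exact hc.eventually h1
  have : LocallyConnectedSpace M := ChartedSpace.locallyConnectedSpace ℂ M
  obtain ⟨V, hVU, hVo, hpV, hVc⟩ := locallyConnectedSpace_iff_subsets_isOpen_isConnected.1 this
    (ι p).1 _ (hgs.and (h2.and hr))
  refine ⟨V, g, σ, hVo, hVc, hpV, fun w hw => (hVU hw).1.contMDiffWithinAt, fun w hw => ?_, hl⟩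
  obtain ⟨h3, h4, h5⟩ := hVU hw
  refine ⟨h5, ?_, h4⟩
  rw [h5]
  exact h3

/-- The germs at `z` of the local graphs of the curve `ι : R → M × ℂ`. -/
def localBranchGerms (ι : R → M × ℂ) (z : M) : Set (Germ (𝓝 z) ℂ) :=
  {γ | ∃ (p : R) (g : M → ℂ), (ι p).1 = z ∧ IsLocalBranchAt ι p g ∧ γ = g}

/-- A curve whose translates are the leaves of a foliation is the graph of the complete analytic
function formed by its local branches. -/
noncomputable def TranslatesFoliate.multivaluedFunction [T2Space M] [ConnectedSpace R]
    (hι : IsInjectiveImmersion ι) (h : TranslatesFoliate ι) : MultivaluedFunction M where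
  sing := (Prod.fst '' translatesUnion ι)ᶜ
  isClosed_sing := (isOpenMap_fst _ h.1.isOpen).isClosed_compl
  countable_sing := h.2.1
  germs := localBranchGerms ι
  germs_nonempty_iff := by
    intro z
    rw [notMem_compl_iff]
    constructor
    · rintro ⟨_, p, g, rfl, -, -⟩
      exact ⟨ι p, mem_iUnion.2 ⟨0, p, by rw [tTranslate_zero]⟩, rfl⟩
    · rintro ⟨x, hx, rfl⟩
      obtain ⟨c, p, rfl⟩ := mem_iUnion.1 hx
      obtain ⟨V, g, σ, -, -, hpV, -, hσ, -⟩ := h.exists_section hι p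
      exact ⟨g, σ (ι p).1, g, (hσ _ hpV).1, (hσ _ hpV).2, rfl⟩
  continuation := by
    intro z hz
    rw [notMem_compl_iff] at hz
    obtain ⟨x, hx, rfl⟩ := hz
    obtain ⟨c, p, rfl⟩ := mem_iUnion.1 hx
    obtain ⟨V, g, σ, hVo, hVc, hpV, hg, hσ, -⟩ := h.exists_section hι p
    refine ⟨V, hVo, hVc, hpV, ?_, ?_⟩
    · intro w hw
      rw [compl_compl]
      exact ⟨ι (σ w), mem_iUnion.2 ⟨0, σ w, by rw [tTranslate_zero]⟩, (hσ w hw).1⟩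
    · rintro w hw _ ⟨p', k, rfl, hk, rfl⟩
      set d := (ι p').2 - (ι (σ (ι p').1)).2 with hd
      have hrange := h.range_tTranslate_eq (hσ _ hw).1
      refine ⟨fun w => g w + d, ⟨hVo, hVc, hg.add contMDiffOn_const, fun y hy => ?_⟩, ?_⟩
      · obtain ⟨q', hq', hl⟩ := h.exists_isLocalBranchAt_add hι hrange (hσ y hy).2
        exact ⟨q', _, (congrArg Prod.fst hq').trans (hσ y hy).1, hl, rfl⟩
      · obtain ⟨q', hq', hl⟩ := h.exists_isLocalBranchAt_add hι hrange (hσ _ hw).2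
        have : q' = p' := by
          refine hι.injective (hq'.trans (Prod.ext (hσ _ hw).1 ?_))
          simp [tTranslate]
        subst this
        exact Germ.coe_eq.2 (hl.eventuallyEq hι hk)
  connected := by
    rintro _ _ _ ⟨p, g, rfl, hg, rfl⟩ _ ⟨q, k, rfl, hk, rfl⟩
    refine (isPreconnected_univ (α := R)).induction₂ (fun p q => ∀ g k : M → ℂ,
      IsLocalBranchAt ι p g → IsLocalBranchAt ι q k → Relation.ReflTransGen
        (DirectContinuation (localBranchGerms ι)) ⟨(ι p).1, (g : Germ (𝓝 (ι p).1) ℂ)⟩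
        ⟨(ι q).1, (k : Germ (𝓝 (ι q).1) ℂ)⟩) ?_ ?_ ?_ (mem_univ p) (mem_univ q) g k hg hk
    · intro x _
      obtain ⟨V, g, σ, hVo, hVc, hxV, hg, hσ, hl⟩ := h.exists_section hι x
      rw [nhdsWithin_univ]
      filter_upwards [hl, (hι.contMDiff_fst x).continuousAt (hVo.mem_nhds hxV)] with y hy hyV
      intro g₁ k₁ hg₁ hk₁
      have hx : σ (ι x).1 = x := hl.self_of_nhds
      refine Relation.ReflTransGen.single ⟨V, g, ⟨hVo, hVc, hg, fun w hw =>
        ⟨σ w, g, (hσ w hw).1, (hσ w hw).2, rfl⟩⟩, hxV, hyV, ?_, ?_⟩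
      · have := (hσ _ hxV).2
        rw [hx] at this
        exact Germ.coe_eq.2 (this.eventuallyEq hι hg₁)
      · have := (hσ _ hyV).2
        rw [hy] at this
        exact Germ.coe_eq.2 (this.eventuallyEq hι hk₁)
    · intro x y z _ _ _ hxy hyz g₁ k₁ hg₁ hk₁
      obtain ⟨V, g, σ, -, -, hyV, -, hσ, hl⟩ := h.exists_section hι y
      have hy : σ (ι y).1 = y := hl.self_of_nhds
      have hgy := (hσ _ hyV).2
      rw [hy] at hgy
      exact (hxy _ _ hg₁ hgy).trans (hyz _ _ hgy hk₁)
    · intro x y _ _ hxy g₁ k₁ hg₁ hk₁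
      have : Std.Symm (DirectContinuation (localBranchGerms ι)) := by
        refine ⟨?_⟩
        rintro a b ⟨V, g, h1, h2, h3, h4, h5⟩
        exact ⟨V, g, h1, h3, h2, h5, h4⟩
      exact Relation.ReflTransGen.stdSymm.symm _ _ (hxy _ _ hk₁ hg₁)

/-- A curve whose translates are the leaves of a foliation without horizontal plaques is the graph
of a nonconstant additively automorphic function. -/
theorem TranslatesFoliate.isAdditivelyAutomorphicGraph [T2Space M] [ConnectedSpace R]
    (hι : IsInjectiveImmersion ι) (h : TranslatesFoliate ι) : IsAdditivelyAutomorphicGraph ι := by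
  refine ⟨h.multivaluedFunction hι, ?_, ?_, ?_, ?_⟩
  · rintro _ _ ⟨p, g, rfl, hg, rfl⟩ _ ⟨p', k, hp', hk, rfl⟩
    refine ⟨(ι p).2 - (ι p').2, germ_add_const_eq_iff.2 ?_⟩
    obtain ⟨q, hq, hl⟩ := h.exists_isLocalBranchAt_add hι (h.range_tTranslate_eq hp') hk
    have : q = p := hι.injective (hq.trans (Prod.ext hp' (by simp [tTranslate])))
    subst this
    exact hg.eventuallyEq hι hl
  · obtain ⟨p⟩ := (inferInstance : Nonempty R)
    obtain ⟨V, g, σ, -, -, hpV, -, hσ, hl⟩ := h.exists_section hι p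
    have hp : σ (ι p).1 = p := hl.self_of_nhds
    have hgp := (hσ _ hpV).2
    rw [hp] at hgp
    refine ⟨(ι p).1, g, ⟨p, g, rfl, hgp, rfl⟩, fun a ha => ?_⟩
    have ha' : ∀ᶠ w in 𝓝 (ι p).1, g w = a := Germ.coe_eq.1 ha
    have h1 : ∀ᶠ q in 𝓝 p, (ι q).2 = a := by
      filter_upwards [hgp.2, (hι.contMDiff_fst p).continuousAt.eventually ha'] with q h1 h2
      rw [h1, h2]
    obtain ⟨W, hW, hWo, hpW⟩ := eventually_nhds_iff.1 h1
    refine h.2.2 0 ⟨W, (fun q => (ι q).1) '' W, a, hWo, ?_, ⟨_, p, hpW, rfl⟩, ?_⟩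
    · rw [isOpen_iff_mem_nhds]
      rintro _ ⟨q, hq, rfl⟩
      obtain ⟨V', g', σ', -, -, hqV, -, hσ', hl'⟩ := h.exists_section hι q
      have hq' : σ' (ι q).1 = q := hl'.self_of_nhds
      have hgq := (hσ' _ hqV).2
      rw [hq'] at hgq
      exact hgq.nhds_le_map hι (image_mem_map (hWo.mem_nhds hq))
    · rw [tTranslate_zero]
      ext ⟨z, t⟩
      constructor
      · rintro ⟨q, hq, he⟩
        have h2 := hW q hq
        rw [he] at h2
        exact ⟨⟨q, hq, by simp only [he]⟩, h2⟩
      · rintro ⟨⟨q, hq, rfl⟩, ht⟩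
        exact ⟨q, hq, Prod.ext rfl ((hW q hq).trans (mem_singleton_iff.1 ht).symm)⟩
  · intro p
    obtain ⟨V, g, σ, -, -, hpV, -, hσ, hl⟩ := h.exists_section hι p
    have hp : σ (ι p).1 = p := hl.self_of_nhds
    have hgp := (hσ _ hpV).2
    rw [hp] at hgp
    exact ⟨g, ⟨p, g, rfl, hgp, rfl⟩, hgp.2⟩
  · rintro _ _ ⟨p, g, rfl, hg, rfl⟩
    exact ⟨p, Prod.ext rfl hg.apply_eq⟩

end Foliations

/-! ### The vector field dual to an additively automorphic function -/

section DualField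

/-- In a countable closed subset of a locally compact Hausdorff space, the isolated points are
dense. -/
theorem IsClosed.exists_isolated_of_countable {Y : Type*} [TopologicalSpace Y] [T2Space Y]
    [LocallyCompactSpace Y] {S U : Set Y} (hS : IsClosed S) (hc : S.Countable) (hU : IsOpen U)
    {z : Y} (hzS : z ∈ S) (hzU : z ∈ U) : ∃ p ∈ U ∩ S, ∀ᶠ w in 𝓝[≠] p, w ∉ S := by
  have : LocallyCompactSpace ↥(S ∩ U) :=
    (hS.isLocallyClosed.inter hU.isLocallyClosed).locallyCompactSpace
  have : Nonempty ↥(S ∩ U) := ⟨⟨z, hzS, hzU⟩⟩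
  have : Countable ↥(S ∩ U) := (hc.mono inter_subset_left).to_subtype
  obtain ⟨y, hy⟩ := nonempty_interior_of_iUnion_of_closed
    (f := fun y : ↥(S ∩ U) => {y}) (fun y => isClosed_singleton) (iUnion_of_singleton _)
  obtain ⟨x, hx⟩ := hy
  have hxy : x = y := mem_singleton_iff.1 (interior_subset hx)
  subst hxy
  obtain ⟨O, hO, hOx⟩ := isOpen_induced_iff.1 (isOpen_interior (s := {x}))
  have hxO : (x : Y) ∈ O := by
    have : x ∈ Subtype.val ⁻¹' O := by rw [hOx]; exact hx
    exact this
  refine ⟨x, ⟨x.2.2, x.2.1⟩, eventually_nhdsWithin_iff.2 ?_⟩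
  filter_upwards [hO.mem_nhds hxO, hU.mem_nhds x.2.2] with w hwO hwU hwx hwS
  have h1 : (⟨w, hwS, hwU⟩ : ↥(S ∩ U)) ∈ Subtype.val ⁻¹' O := hwO
  rw [hOx] at h1
  exact hwx (congrArg Subtype.val (mem_singleton_iff.1 (interior_subset h1)))

variable {M : Type*} [TopologicalSpace M] [ChartedSpace ℂ M]

theorem MultivaluedFunction.dense_compl_sing (Ψ : MultivaluedFunction M) : Dense Ψ.singᶜ :=
  Ψ.countable_sing.dense_compl_of_chartedSpace

variable [IsManifold 𝓘(ℂ) ω M]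

theorem dAt_comp_chart {H : ℂ → ℂ} {p z : M} (hz : z ∈ (chartAt ℂ p).source)
    (hH : AnalyticAt ℂ H (chartAt ℂ p z)) :
    dAt (H ∘ chartAt ℂ p) z = deriv H (chartAt ℂ p z) * dAt (chartAt ℂ p) z := by
  rw [dAt_eq_deriv_mul hz (hH.contMDiffAt_comp_chart hz)]
  congr 1
  apply Filter.EventuallyEq.deriv_eq
  filter_upwards [(chartAt ℂ p).open_target.mem_nhds ((chartAt ℂ p).map_source hz)] with w hw
  simp [hw]

theorem eventually_dAt_ne_zero {g : M → ℂ} {z : M} (hg : ContMDiffAt 𝓘(ℂ) 𝓘(ℂ) ω g z)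
    (h : dAt g z ≠ 0) : ∀ᶠ w in 𝓝 z, dAt g w ≠ 0 := by
  have hz := mem_chart_source ℂ z
  have h1 : ContinuousAt (fun w => deriv (g ∘ (chartAt ℂ z).symm) (chartAt ℂ z w)) z :=
    (analyticAt_comp_chart_symm hz hg).deriv.continuousAt.comp
      (f := chartAt ℂ z) ((chartAt ℂ z).continuousAt hz)
  rw [dAt_eq_deriv_mul hz hg] at h
  filter_upwards [h1.eventually_ne (left_ne_zero_of_mul h), chart_source_mem_nhds ℂ z,
    hg.eventually_contMDiffAt] with w h2 h3 h4
  rw [dAt_eq_deriv_mul h3 h4]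
  exact mul_ne_zero h2 (dAt_chart_ne_zero h3)

/-- The critical points of a nonconstant holomorphic function are isolated. -/
theorem eventually_nhdsNE_dAt_ne_zero {g : M → ℂ} {z : M} (hg : ContMDiffAt 𝓘(ℂ) 𝓘(ℂ) ω g z)
    (h : ¬ ∀ᶠ w in 𝓝 z, g w = g z) : ∀ᶠ w in 𝓝[≠] z, dAt g w ≠ 0 := by
  have hz := mem_chart_source ℂ z
  have h1 := (analyticAt_comp_chart_symm hz hg).deriv
  rcases h1.eventually_eq_zero_or_eventually_ne_zero with h2 | h2
  · exfalso
    have h3 : ∀ᶠ w in 𝓝 z, deriv (g ∘ (chartAt ℂ z).symm) (chartAt ℂ z w) = 0 :=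
      ((chartAt ℂ z).continuousAt hz).eventually h2
    obtain ⟨a, ha⟩ := eventually_eq_add_const_of_dAt_eq hg (h := fun _ => g z) contMDiffAt_const
      (by
        filter_upwards [h3, hg.eventually_contMDiffAt, chart_source_mem_nhds ℂ z] with w h4 h5 h6
        have h7 : dAt (fun _ : M => g z) w = 0 := by
          unfold dAt
          rw [mfderiv_const]
          rfl
        rw [dAt_eq_deriv_mul h6 h5, h4, zero_mul, h7])
    have h8 : g z = g z + a := ha.self_of_nhds
    refine h ?_
    filter_upwards [ha] with w hw
    rw [hw, ← h8]
  · have h3 : ∀ᶠ w in 𝓝[≠] z, deriv (g ∘ (chartAt ℂ z).symm) (chartAt ℂ z w) ≠ 0 := by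
      rw [← map_chart_symm_nhdsNE hz, eventually_map]
      filter_upwards [h2, nhdsWithin_le_nhds (chart_target_mem_nhds ℂ z)] with w h4 h5
      rwa [(chartAt ℂ z).right_inv h5]
    filter_upwards [h3, (hg.eventually_contMDiffAt).filter_mono nhdsWithin_le_nhds,
      nhdsWithin_le_nhds (chart_source_mem_nhds ℂ z)] with w h4 h5 h6
    rw [dAt_eq_deriv_mul h6 h5]
    exact mul_ne_zero h4 (dAt_chart_ne_zero h6)

namespace MultivaluedFunction

/-- The function `h` is a local primitive, with nonzero differential at `z`, of the `1`-form `dΨ`: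
near `z` it has the same differential as all branches of `Ψ`. The point `z` may belong to the
singular set of `Ψ`; then `dΨ` extends holomorphically to `z`. -/
def IsLocalPrimitiveAt (Ψ : MultivaluedFunction M) (h : M → ℂ) (z : M) : Prop :=
  ContMDiffAt 𝓘(ℂ) 𝓘(ℂ) ω h z ∧ dAt h z ≠ 0 ∧
    ∀ᶠ w in 𝓝 z, ∀ g : M → ℂ, (g : Germ (𝓝 w) ℂ) ∈ Ψ.germs w → dAt g w = dAt h w

/-- The vector field dual to the `1`-form `dΨ`, and to its holomorphic extension without zero to
points of the singular set of `Ψ`, where there is one. Its value is `0` at all other points. -/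
noncomputable def dualField (Ψ : MultivaluedFunction M) (z : M) : TangentSpace 𝓘(ℂ) z :=
  open Classical in
  if h : ∃ h, Ψ.IsLocalPrimitiveAt h z then (show ℂ from (dAt h.choose z)⁻¹) else (0 : ℂ)

variable {Ψ : MultivaluedFunction M}

/-- The dual field does not depend on the choice of a local primitive, as the singular set of `Ψ`
has dense complement. -/
theorem IsLocalPrimitiveAt.dualField_eq {h : M → ℂ} {z : M} (hh : Ψ.IsLocalPrimitiveAt h z) :
    (show ℂ from Ψ.dualField z) = (dAt h z)⁻¹ := by
  have hex : ∃ h, Ψ.IsLocalPrimitiveAt h z := ⟨h, hh⟩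
  have h1 : (show ℂ from Ψ.dualField z) = (dAt hex.choose z)⁻¹ := dif_pos hex
  rw [h1]
  congr 1
  refine dAt_eq_of_frequently hex.choose_spec.1 hh.1 ?_
  refine ((mem_closure_iff_frequently.1 (Ψ.dense_compl_sing z)).and_eventually
    (hex.choose_spec.2.2.and hh.2.2)).mono ?_
  rintro w ⟨hw, h2, h3⟩
  obtain ⟨g, hg⟩ := Ψ.exists_germ hw
  exact (h2 g hg).symm.trans (h3 g hg)

theorem dualField_ne_zero_iff {z : M} :
    Ψ.dualField z ≠ 0 ↔ ∃ h, Ψ.IsLocalPrimitiveAt h z := by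
  constructor
  · intro h
    by_contra hne
    exact h (dif_neg hne)
  · rintro ⟨h, hh⟩ h0
    exact inv_ne_zero hh.2.1 (hh.dualField_eq.symm.trans h0)

theorem IsLocalPrimitiveAt.eventually {h : M → ℂ} {z : M} (hh : Ψ.IsLocalPrimitiveAt h z) :
    ∀ᶠ w in 𝓝 z, Ψ.IsLocalPrimitiveAt h w := by
  filter_upwards [hh.1.eventually_contMDiffAt, eventually_dAt_ne_zero hh.1 hh.2.1,
    hh.2.2.eventually_nhds] with w h1 h2 h3
  exact ⟨h1, h2, h3⟩

theorem isClosed_dualField_eq_zero (Ψ : MultivaluedFunction M) :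
    IsClosed {z | Ψ.dualField z = 0} := by
  rw [← isOpen_compl_iff, isOpen_iff_mem_nhds]
  intro z hz
  obtain ⟨h, hh⟩ := dualField_ne_zero_iff.1 hz
  filter_upwards [hh.eventually] with w hw
  exact dualField_ne_zero_iff.2 ⟨h, hw⟩

theorem IsLocalPrimitiveAt.coeffAt_eq {h : M → ℂ} {p z : M} (hh : Ψ.IsLocalPrimitiveAt h z)
    (hz : z ∈ (chartAt ℂ p).source) :
    coeffAt Ψ.dualField p (chartAt ℂ p z) =
      (deriv (h ∘ (chartAt ℂ p).symm) (chartAt ℂ p z))⁻¹ := by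
  rw [coeffAt_chart_eq hz, hh.dualField_eq, dAt_eq_deriv_mul hz hh.1, mul_inv]
  exact inv_mul_cancel_right₀ (dAt_chart_ne_zero hz) _

theorem IsLocalPrimitiveAt.analyticAt_coeffAt {h : M → ℂ} {p z : M}
    (hh : Ψ.IsLocalPrimitiveAt h z) (hz : z ∈ (chartAt ℂ p).source) :
    AnalyticAt ℂ (coeffAt Ψ.dualField p) (chartAt ℂ p z) ∧
      coeffAt Ψ.dualField p (chartAt ℂ p z) ≠ 0 := by
  have h1 : deriv (h ∘ (chartAt ℂ p).symm) (chartAt ℂ p z) ≠ 0 := by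
    have := hh.2.1
    rw [dAt_eq_deriv_mul hz hh.1] at this
    exact left_ne_zero_of_mul this
  refine ⟨((analyticAt_comp_chart_symm hz hh.1).deriv.inv h1).congr ?_, ?_⟩
  · have h2 : ∀ᶠ x in 𝓝 (chartAt ℂ p z), Ψ.IsLocalPrimitiveAt h ((chartAt ℂ p).symm x) := by
      rw [← eventually_map (P := fun w => Ψ.IsLocalPrimitiveAt h w), map_chart_symm_nhds hz]
      exact hh.eventually
    filter_upwards [h2, (chartAt ℂ p).open_target.mem_nhds ((chartAt ℂ p).map_source hz)]
      with x h3 h4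
    have := h3.coeffAt_eq ((chartAt ℂ p).map_target h4)
    rw [(chartAt ℂ p).right_inv h4] at this
    exact this.symm
  · rw [hh.coeffAt_eq hz]
    exact inv_ne_zero h1

/-- A noncritical branch of an additively automorphic function is a local primitive of `dΨ`. -/
theorem AdditivelyAutomorphic.isLocalPrimitiveAt (hA : Ψ.AdditivelyAutomorphic) {z : M}
    {g : M → ℂ} (hg : (g : Germ (𝓝 z) ℂ) ∈ Ψ.germs z) (hd : dAt g z ≠ 0) :
    Ψ.IsLocalPrimitiveAt g z := by
  obtain ⟨h1, h2⟩ := Ψ.eventually_of_mem_germs hg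
  refine ⟨h1, hd, ?_⟩
  filter_upwards [h2] with w hw k hk
  rw [(hA.eventuallyEq hk hw).dAt_eq, dAt_add_const (Ψ.contMDiffAt_of_mem_germs hw)]

theorem AdditivelyAutomorphic.countable_dualField_eq_zero [SecondCountableTopology M]
    (hA : Ψ.AdditivelyAutomorphic) (hN : Ψ.Nonconstant) : {z | Ψ.dualField z = 0}.Countable := by
  have key : ∀ z ∈ {z | Ψ.dualField z = 0} \ Ψ.sing,
      {z} ∈ 𝓝[{z | Ψ.dualField z = 0} \ Ψ.sing] z := by
    rintro z ⟨-, hz⟩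
    obtain ⟨g, hg⟩ := Ψ.exists_germ hz
    obtain ⟨h1, h2⟩ := Ψ.eventually_of_mem_germs hg
    have h3 := eventually_nhdsNE_dAt_ne_zero h1 (Ψ.not_eventually_const hA hN hg _)
    rw [eventually_nhdsWithin_iff] at h3
    rw [mem_nhdsWithin_iff_eventually]
    filter_upwards [h2, h3] with w h4 h5 h6
    by_contra hne
    exact dualField_ne_zero_iff.2 ⟨g, hA.isLocalPrimitiveAt h4 (h5 hne)⟩ h6.1
  obtain ⟨t, -, htc, ht⟩ := TopologicalSpace.countable_cover_nhdsWithin key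
  rw [biUnion_of_singleton] at ht
  refine (Ψ.countable_sing.union htc).mono fun z hz => ?_
  by_cases hs : z ∈ Ψ.sing
  · exact Or.inl hs
  · exact Or.inr (ht ⟨hz, hs⟩)

/-- If the coefficient of the dual field has order `0` at an isolated point of its zero set, its
inverse extends to a holomorphic function, a primitive of which is a local primitive of `dΨ`. -/
theorem exists_isLocalPrimitiveAt_of_order_eq_zero {p : M}
    (hp : ∀ᶠ w in 𝓝[≠] p, Ψ.dualField w ≠ 0)
    (hm : MeromorphicAt (coeffAt Ψ.dualField p) (chartAt ℂ p p))
    (ho : meromorphicOrderAt (coeffAt Ψ.dualField p) (chartAt ℂ p p) = 0) :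
    ∃ h, Ψ.IsLocalPrimitiveAt h p := by
  have hps := mem_chart_source ℂ p
  obtain ⟨F, hF, hF0, hcF⟩ := (meromorphicOrderAt_eq_int_iff (n := 0) hm).1 ho
  simp only [zpow_zero, one_smul] at hcF
  obtain ⟨r, hr, hball⟩ := Metric.eventually_nhds_iff_ball.1
    ((hF.inv hF0).eventually_analyticAt.and (hF.continuousAt.eventually_ne hF0))
  obtain ⟨H, hH⟩ := DifferentiableOn.isExactOn_ball (f := F⁻¹) (c := chartAt ℂ p p) (r := r)
    fun x hx => (hball x hx).1.differentiableAt.differentiableWithinAt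
  have hHa : ∀ x ∈ Metric.ball (chartAt ℂ p p) r, AnalyticAt ℂ H x := fun x hx =>
    DifferentiableOn.analyticAt (s := Metric.ball (chartAt ℂ p p) r)
      (fun y hy => (hH y hy).differentiableAt.differentiableWithinAt)
      (Metric.isOpen_ball.mem_nhds hx)
  have hd : ∀ z ∈ (chartAt ℂ p).source, chartAt ℂ p z ∈ Metric.ball (chartAt ℂ p p) r →
      dAt (H ∘ chartAt ℂ p) z = (F (chartAt ℂ p z))⁻¹ * dAt (chartAt ℂ p) z := by
    intro z hz hzr
    rw [dAt_comp_chart hz (hHa _ hzr), (hH _ hzr).deriv, Pi.inv_apply]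
  have hp0 := Metric.mem_ball_self (x := chartAt ℂ p p) hr
  have hhc : ContMDiffAt 𝓘(ℂ) 𝓘(ℂ) ω (H ∘ chartAt ℂ p) p :=
    (hHa _ hp0).contMDiffAt_comp_chart hps
  have hpunct : ∀ᶠ w in 𝓝[≠] p, ∀ g : M → ℂ, (g : Germ (𝓝 w) ℂ) ∈ Ψ.germs w →
      dAt g w = dAt (H ∘ chartAt ℂ p) w := by
    have h1 : ∀ᶠ w in 𝓝[≠] p, coeffAt Ψ.dualField p (chartAt ℂ p w) = F (chartAt ℂ p w) := by
      rw [← map_chart_symm_nhdsNE hps, eventually_map]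
      filter_upwards [hcF, nhdsWithin_le_nhds (chart_target_mem_nhds ℂ p)] with x h2 h3
      rwa [(chartAt ℂ p).right_inv h3]
    filter_upwards [hp, h1, nhdsWithin_le_nhds (chart_source_mem_nhds ℂ p), nhdsWithin_le_nhds
      ((chartAt ℂ p).continuousAt hps (Metric.ball_mem_nhds _ hr))] with w h2 h3 h4 h5 g hg
    obtain ⟨k, hk⟩ := dualField_ne_zero_iff.1 h2
    rw [hk.2.2.self_of_nhds g hg, hd w h4 h5, ← h3, hk.coeffAt_eq h4, inv_inv]
    exact dAt_eq_deriv_mul h4 hk.1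
  refine ⟨H ∘ chartAt ℂ p, hhc, ?_, ?_⟩
  · rw [hd p hps hp0]
    exact mul_ne_zero (inv_ne_zero hF0) (dAt_chart_ne_zero hps)
  · filter_upwards [eventually_nhdsWithin_iff.1 hpunct] with w hw g hg
    by_cases hwp : w = p
    · -- if `p` is not singular for `Ψ`, the equality at `p` follows by continuity
      subst hwp
      have := nhdsNE_neBot_of_chartedSpace w
      obtain ⟨h1, h2⟩ := Ψ.eventually_of_mem_germs hg
      refine dAt_eq_of_frequently h1 hhc (Filter.Frequently.filter_mono
        (Filter.Eventually.frequently ?_) (nhdsWithin_le_nhds (s := {w}ᶜ)))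
      filter_upwards [hpunct, h2.filter_mono nhdsWithin_le_nhds] with x h3 h4
      exact h3 g h4
    · exact hw hwp g hg

/-- An isolated point of the zero set of the dual field is a zero, a pole or an isolated essential
singularity. -/
theorem singular_of_isolated {p : M} (hp0 : Ψ.dualField p = 0)
    (hp : ∀ᶠ w in 𝓝[≠] p, Ψ.dualField w ≠ 0) :
    IsZeroAt Ψ.dualField p ∨ IsPoleAt Ψ.dualField p ∨ IsEssentialAt Ψ.dualField p := by
  have hps := mem_chart_source ℂ p
  set c := coeffAt Ψ.dualField p with hc
  have hcp : c (chartAt ℂ p p) = 0 := by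
    rw [hc, coeffAt_chart_eq hps, hp0]
    exact zero_mul _
  have h1 : ∀ᶠ x in 𝓝[≠] (chartAt ℂ p p), AnalyticAt ℂ c x ∧ c x ≠ 0 := by
    have h2 : ∀ᶠ x in 𝓝[≠] (chartAt ℂ p p), Ψ.dualField ((chartAt ℂ p).symm x) ≠ 0 := by
      rw [← eventually_map (P := fun w => Ψ.dualField w ≠ 0), map_chart_symm_nhdsNE hps]
      exact hp
    filter_upwards [h2, nhdsWithin_le_nhds (chart_target_mem_nhds ℂ p)] with x h3 h4
    obtain ⟨h, hh⟩ := dualField_ne_zero_iff.1 h3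
    have := hh.analyticAt_coeffAt ((chartAt ℂ p).map_target h4)
    rwa [(chartAt ℂ p).right_inv h4] at this
  by_cases hm : MeromorphicAt c (chartAt ℂ p p)
  · rcases lt_trichotomy (meromorphicOrderAt c (chartAt ℂ p p)) 0 with ho | ho | ho
    · exact Or.inr (Or.inl ⟨hm, ho⟩)
    · exact absurd hp0 (dualField_ne_zero_iff.2
        (exists_isLocalPrimitiveAt_of_order_eq_zero hp hm ho))
    · refine Or.inl ⟨AnalyticAt.of_meromorphicOrderAt_pos ho hcp, hcp, fun h0 => ?_⟩
      obtain ⟨x, hx1, hx2⟩ := (h1.and (h0.filter_mono nhdsWithin_le_nhds)).exists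
      exact hx1.2 hx2
  · exact Or.inr (Or.inr ⟨h1.mono fun x hx => hx.1, hm⟩)

/-- The dual of the `1`-form `dΨ`, as a singular complex analytic vector field. -/
noncomputable def dualVectorField [T2Space M] [SecondCountableTopology M]
    (Ψ : MultivaluedFunction M) (hA : Ψ.AdditivelyAutomorphic) (hN : Ψ.Nonconstant) :
    SingularVectorField M where
  toFun := Ψ.dualField
  holomorphic := by
    intro z hz
    obtain ⟨h, hh⟩ := dualField_ne_zero_iff.1 hz
    exact (hh.analyticAt_coeffAt (mem_chart_source ℂ z)).1
  singular := by
    intro z hz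
    rw [mem_closure_iff]
    intro U hU hzU
    have : LocallyCompactSpace M := ChartedSpace.locallyCompactSpace ℂ M
    obtain ⟨p, hp, hpi⟩ := Ψ.isClosed_dualField_eq_zero.exists_isolated_of_countable
      (hA.countable_dualField_eq_zero hN) hU hz hzU
    exact ⟨p, hp.1, singular_of_isolated hp.2 hpi⟩

end MultivaluedFunction

end DualField

/-! ### Uniqueness of the vector field and the equivalence -/

section Uniqueness

variable {M : Type*} [TopologicalSpace M] [ChartedSpace ℂ M]

/-- Near a zero, a pole or an isolated essential singularity, a vector field does not vanish
identically. -/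
theorem not_eventually_eq_zero_of_singular {X : ∀ z : M, TangentSpace 𝓘(ℂ) z} {p : M}
    (hX : IsZeroAt X p ∨ IsPoleAt X p ∨ IsEssentialAt X p) : ¬ ∀ᶠ w in 𝓝 p, X w = 0 := by
  intro h
  have h1 : ∀ᶠ x in 𝓝 (chartAt ℂ p p), coeffAt X p x = 0 := by
    have h2 : ∀ᶠ x in 𝓝 (chartAt ℂ p p), X ((chartAt ℂ p).symm x) = 0 := by
      rw [← eventually_map (P := fun w => X w = 0), map_chart_symm_nhds (mem_chart_source ℂ p)]
      exact h
    filter_upwards [h2] with x hx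
    unfold coeffAt
    rw [hx]
    exact (mfderiv 𝓘(ℂ) 𝓘(ℂ) (chartAt ℂ p) ((chartAt ℂ p).symm x)).map_zero
  have h2 : coeffAt X p =ᶠ[𝓝[≠] (chartAt ℂ p p)] fun _ => 0 := h1.filter_mono nhdsWithin_le_nhds
  rcases hX with hX | hX | hX
  · exact hX.2.2 h1
  · have h3 := hX.2
    rw [meromorphicOrderAt_eq_top_iff.2 h2] at h3
    exact not_top_lt h3
  · exact hX.2 ((analyticAt_const (v := (0 : ℂ))).meromorphicAt.congr h2.symm)

/-- A vector field is holomorphic on a punctured neighbourhood of a zero, a pole or an isolated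
essential singularity. -/
theorem eventually_analyticAt_of_singular {X : ∀ z : M, TangentSpace 𝓘(ℂ) z} {p : M}
    (hX : IsZeroAt X p ∨ IsPoleAt X p ∨ IsEssentialAt X p) :
    ∀ᶠ x in 𝓝[≠] (chartAt ℂ p p), AnalyticAt ℂ (coeffAt X p) x := by
  rcases hX with hX | hX | hX
  · exact hX.1.eventually_analyticAt.filter_mono nhdsWithin_le_nhds
  · exact hX.1.eventually_analyticAt
  · exact hX.1

/-- The singular set is nowhere dense. -/
theorem SingularVectorField.dense_ne_zero (X : SingularVectorField M) :
    Dense {z | X.toFun z ≠ 0} := by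
  rw [dense_iff_inter_open]
  intro U hU hne
  by_contra h
  have h0 : ∀ w ∈ U, X.toFun w = 0 := fun w hw => by
    by_contra hw0
    exact h ⟨w, hw, hw0⟩
  obtain ⟨z, hz⟩ := hne
  obtain ⟨p, hpU, hp⟩ := mem_closure_iff.1 (X.singular z (h0 z hz)) U hU hz
  refine not_eventually_eq_zero_of_singular hp ?_
  filter_upwards [hU.mem_nhds hpU] with w hw using h0 w hw

theorem FollowsDiagram.mul_dAt_eq_one {R : Type*} [TopologicalSpace R] [ChartedSpace ℂ R]
    {ι : R → M × ℂ} {X : SingularVectorField M} {Ψ : MultivaluedFunction M}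
    (h : FollowsDiagram ι X Ψ) {z : M} (hz : X.toFun z ≠ 0) {g : M → ℂ}
    (hg : (g : Germ (𝓝 z) ℂ) ∈ Ψ.germs z) : (show ℂ from X.toFun z) * dAt g z = 1 := by
  rw [← mfderiv_apply_eq_mul]
  exact h.primitive z hz g hg

variable [IsManifold 𝓘(ℂ) ω M]

theorem coeffAt_ne_zero_iff {X : ∀ z : M, TangentSpace 𝓘(ℂ) z} {p z : M}
    (hz : z ∈ (chartAt ℂ p).source) : coeffAt X p (chartAt ℂ p z) ≠ 0 ↔ X z ≠ 0 := by
  rw [coeffAt_chart_eq hz, mul_ne_zero_iff]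
  exact and_iff_left (dAt_chart_ne_zero hz)

theorem SingularVectorField.isOpen_ne_zero (X : SingularVectorField M) :
    IsOpen {z | X.toFun z ≠ 0} := by
  rw [isOpen_iff_mem_nhds]
  intro z hz
  have hzs := mem_chart_source ℂ z
  have h1 := (X.holomorphic z hz).continuousAt.eventually_ne ((coeffAt_ne_zero_iff hzs).2 hz)
  filter_upwards [((chartAt ℂ z).continuousAt hzs).eventually h1, chart_source_mem_nhds ℂ z]
    with w h2 h3
  exact (coeffAt_ne_zero_iff h3).1 h2

/-- If two singular vector fields agree on a dense set, then the regular points of the one are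
regular points of the other: a singular point of the second among them would be removable. -/
theorem SingularVectorField.ne_zero_of_dense {X Y : SingularVectorField M}
    (hXY : Dense {z | X.toFun z = Y.toFun z}) {z : M} (hz : X.toFun z ≠ 0) :
    Y.toFun z ≠ 0 := by
  intro hYz
  obtain ⟨p, hpX, hp⟩ := mem_closure_iff.1 (Y.singular z hYz) _ X.isOpen_ne_zero hz
  have hps := mem_chart_source ℂ p
  have hXa := X.holomorphic p hpX
  have hXne := (coeffAt_ne_zero_iff hps).2 hpX
  have hYa := eventually_analyticAt_of_singular hp
  have heq : coeffAt Y.toFun p =ᶠ[𝓝[≠] (chartAt ℂ p p)] coeffAt X.toFun p := by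
    filter_upwards [hYa, hXa.eventually_analyticAt.filter_mono nhdsWithin_le_nhds,
      nhdsWithin_le_nhds (chart_target_mem_nhds ℂ p)] with x h1 h2 h3
    refine tendsto_nhds_unique_of_frequently_eq h1.continuousAt h2.continuousAt ?_
    have h4 : ∃ᶠ w in 𝓝 ((chartAt ℂ p).symm x), X.toFun w = Y.toFun w :=
      mem_closure_iff_frequently.1 (hXY _)
    have h5 := map_chart_symm_nhds ((chartAt ℂ p).map_target h3)
    rw [(chartAt ℂ p).right_inv h3] at h5
    rw [← h5, frequently_map] at h4
    refine h4.mono fun y hy => ?_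
    unfold coeffAt
    rw [hy]
  rcases hp with hp | hp | hp
  · refine hXne ?_
    have := nhdsNE_neBot_of_chartedSpace p
    rw [← hp.2.1]
    exact tendsto_nhds_unique_of_frequently_eq hXa.continuousAt hp.1.continuousAt
      (heq.symm.frequently.filter_mono nhdsWithin_le_nhds)
  · have h1 := hp.2
    rw [meromorphicOrderAt_congr heq] at h1
    exact absurd h1 (not_lt.2 hXa.meromorphicOrderAt_nonneg)
  · exact hp.2 (hXa.meromorphicAt.congr heq.symm)

theorem SingularVectorField.eq_of_dense {X Y : SingularVectorField M}
    (hXY : Dense {z | X.toFun z = Y.toFun z}) : X = Y := by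
  have hYX : Dense {z | Y.toFun z = X.toFun z} := by
    convert hXY using 3
    exact eq_comm
  have h : X.toFun = Y.toFun := by
    funext z
    by_cases hX : X.toFun z = 0
    · rw [hX]
      by_contra hY
      exact ne_zero_of_dense hYX (Ne.symm hY) hX
    · have hY := ne_zero_of_dense hXY hX
      have hzs := mem_chart_source ℂ z
      have h1 : coeffAt X.toFun z (chartAt ℂ z z) = coeffAt Y.toFun z (chartAt ℂ z z) := by
        refine tendsto_nhds_unique_of_frequently_eq (X.holomorphic z hX).continuousAt
          (Y.holomorphic z hY).continuousAt ?_
        have h4 : ∃ᶠ w in 𝓝 z, X.toFun w = Y.toFun w := mem_closure_iff_frequently.1 (hXY _)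
        rw [← map_chart_symm_nhds hzs, frequently_map] at h4
        refine h4.mono fun y hy => ?_
        unfold coeffAt
        rw [hy]
      rw [coeffAt_chart_eq hzs, coeffAt_chart_eq hzs] at h1
      exact mul_right_cancel₀ (M₀ := ℂ) (dAt_chart_ne_zero hzs) h1
  cases X
  cases Y
  simpa using h

variable {R : Type*} [TopologicalSpace R] [ChartedSpace ℂ R]
variable {ι : R → M × ℂ}

/-- The vector field of the diagram is unique: on a dense set it is the dual of the differential of
the local branches, which the curve determines. -/
theorem FollowsDiagram.vectorField_eq [IsManifold 𝓘(ℂ) ω R] (hι : IsInjectiveImmersion ι)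
    {X X' : SingularVectorField M} {Ψ Ψ' : MultivaluedFunction M}
    (h : FollowsDiagram ι X Ψ) (h' : FollowsDiagram ι X' Ψ') : X = X' := by
  refine SingularVectorField.eq_of_dense ?_
  have hd : Dense ({z | X.toFun z ≠ 0} ∩ ({z | X'.toFun z ≠ 0} ∩ Ψ.singᶜ)) :=
    X.dense_ne_zero.inter_of_isOpen_left
      (X'.dense_ne_zero.inter_of_isOpen_left Ψ.dense_compl_sing X'.isOpen_ne_zero)
      X.isOpen_ne_zero
  refine hd.mono ?_
  rintro z ⟨hX, hX', hz⟩
  obtain ⟨g, hg⟩ := Ψ.exists_germ hz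
  obtain ⟨p, hp⟩ := h.graph.2 z _ hg
  obtain ⟨k, hk, hkl⟩ := h.graph.exists_isLocalBranchAt p
  obtain ⟨k', hk', hkl'⟩ := h'.graph.exists_isLocalBranchAt p
  have hkk := (hkl.eventuallyEq hι hkl').dAt_eq
  have hp1 : (ι p).1 = z := by rw [hp]
  subst hp1
  have h1 := h.mul_dAt_eq_one hX hk
  have h2 := h'.mul_dAt_eq_one hX' hk'
  rw [← hkk] at h2
  have h3 : dAt k (ι p).1 ≠ 0 := right_ne_zero_of_mul (h1 ▸ one_ne_zero)
  exact mul_right_cancel₀ (M₀ := ℂ) h3 (h1.trans h2.symm)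

/-- Near a regular point of `X`, all branches of `Ψ` have the same differential, the dual of `X`. -/
theorem FollowsDiagram.additivelyAutomorphic [Nonempty M] {X : SingularVectorField M}
    {Ψ : MultivaluedFunction M} (h : FollowsDiagram ι X Ψ) :
    Ψ.AdditivelyAutomorphic ∧ Ψ.Nonconstant := by
  obtain ⟨z, hz, hzs⟩ :=
    (X.dense_ne_zero.inter_of_isOpen_left Ψ.dense_compl_sing X.isOpen_ne_zero).nonempty
  constructor
  · refine Ψ.additivelyAutomorphic_of_exists hzs fun γ hγ δ hδ => ?_
    induction γ using Germ.inductionOn with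
    | h g =>
    induction δ using Germ.inductionOn with
    | h k =>
    obtain ⟨hg, hg'⟩ := Ψ.eventually_of_mem_germs hγ
    obtain ⟨hk, hk'⟩ := Ψ.eventually_of_mem_germs hδ
    have h1 : ∀ᶠ w in 𝓝 z, dAt g w = dAt k w := by
      filter_upwards [hg', hk', X.isOpen_ne_zero.mem_nhds hz] with w h2 h3 h4
      have h5 := h.mul_dAt_eq_one h4 h2
      have h6 := h.mul_dAt_eq_one h4 h3
      exact mul_left_cancel₀ (left_ne_zero_of_mul (h5 ▸ one_ne_zero)) (h5.trans h6.symm)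
    obtain ⟨a, ha⟩ := eventually_eq_add_const_of_dAt_eq hg hk h1
    exact ⟨a, germ_add_const_eq_iff.2 ha⟩
  · obtain ⟨g, hg⟩ := Ψ.exists_germ hzs
    refine ⟨z, g, hg, fun a ha => ?_⟩
    have h1 : dAt g z = dAt (fun _ => a) z := (Germ.coe_eq.1 ha).dAt_eq
    have h2 : dAt (fun _ : M => a) z = 0 := by
      unfold dAt
      rw [mfderiv_const]
      rfl
    have h3 := h.mul_dAt_eq_one hz hg
    rw [h1, h2, mul_zero] at h3
    exact zero_ne_one h3

/-- The graph of a nonconstant additively automorphic function follows the diagram with the dual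
vector field of its differential. -/
theorem IsGraphOf.followsDiagram [T2Space M] [SecondCountableTopology M]
    (hι : IsInjectiveImmersion ι) {Ψ : MultivaluedFunction M} (hG : IsGraphOf ι Ψ)
    (hA : Ψ.AdditivelyAutomorphic) (hN : Ψ.Nonconstant) :
    FollowsDiagram ι (Ψ.dualVectorField hA hN) Ψ := by
  have key : ∀ z, Ψ.dualField z ≠ 0 → ∀ g : M → ℂ, (g : Germ (𝓝 z) ℂ) ∈ Ψ.germs z →
      (show ℂ from Ψ.dualField z) * dAt g z = 1 := by
    intro z hz g hg
    obtain ⟨k, hk⟩ := MultivaluedFunction.dualField_ne_zero_iff.1 hz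
    rw [hk.dualField_eq, hk.2.2.self_of_nhds g hg]
    exact inv_mul_cancel₀ hk.2.1
  refine ⟨hG, ?_, ?_⟩
  · intro p hp v
    obtain ⟨g, hg, hl⟩ := hG.exists_isLocalBranchAt p
    have h1 : mfderiv 𝓘(ℂ) 𝓘(ℂ) (fun q => (ι q).2) p =
        mfderiv 𝓘(ℂ) 𝓘(ℂ) (g ∘ fun q => (ι q).1) p := Filter.EventuallyEq.mfderiv_eq hl.2
    have h2 := mfderiv_comp (I'' := 𝓘(ℂ)) p (g := g) (f := fun q => (ι q).1)
      (hl.1.mdifferentiableAt (by simp)) ((hι.contMDiff_fst p).mdifferentiableAt (by simp))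
    have h3 : (show ℂ from mfderiv 𝓘(ℂ) 𝓘(ℂ) (fun q => (ι q).2) p v) =
        (show ℂ from mfderiv 𝓘(ℂ) 𝓘(ℂ) (fun q => (ι q).1) p v) * dAt g (ι p).1 := by
      rw [← mfderiv_apply_eq_mul, h1, h2]
      rfl
    have h4 := key _ hp g hg
    have h5 : (show ℂ from mfderiv 𝓘(ℂ) 𝓘(ℂ) (fun q => (ι q).1) p v) =
        (show ℂ from mfderiv 𝓘(ℂ) 𝓘(ℂ) (fun q => (ι q).2) p v) *
          (show ℂ from Ψ.dualField (ι p).1) := by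
      rw [h3, mul_assoc, mul_comm (dAt g _), h4, mul_one]
    exact h5
  · intro z hz g hg
    exact (mfderiv_apply_eq_mul g z _).trans (key z hz g hg)

end Uniqueness

theorem mainTheorem6
    {M : Type*} [TopologicalSpace M] [T2Space M] [SecondCountableTopology M] [ConnectedSpace M]
    [ChartedSpace ℂ M] [IsManifold 𝓘(ℂ) ω M]
    {R : Type*} [TopologicalSpace R] [ConnectedSpace R]
    [ChartedSpace ℂ R] [IsManifold 𝓘(ℂ) ω R]
    (ι : R → M × ℂ) (hι : IsInjectiveImmersion ι) :
    List.TFAE [DeterminesVectorField ι, IsAdditivelyAutomorphicGraph ι, TranslatesFoliate ι] := by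
  tfae_have 1 → 2 := by
    rintro ⟨X, ⟨Ψ, h⟩, -⟩
    obtain ⟨hA, hN⟩ := h.additivelyAutomorphic
    exact ⟨Ψ, hA, hN, h.graph⟩
  tfae_have 2 → 1 := by
    rintro ⟨Ψ, hA, hN, hG⟩
    have h := hG.followsDiagram hι hA hN
    exact ⟨Ψ.dualVectorField hA hN, ⟨Ψ, h⟩, fun Y ⟨Ψ', h'⟩ => h'.vectorField_eq hι h⟩
  tfae_have 2 → 3 := fun h => h.translatesFoliate hι
  tfae_have 3 → 2 := fun h => h.isAdditivelyAutomorphicGraph hι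
  tfae_finish
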